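/- Let $k$ be any field of characteristic $p > 0$. Let $m, e, s$ be positive integers such that $m > 1$, $p^e \nmid sp$ and $sp \nmid p^e$, and let $$A = k[X,Y,Z,T]/(X^mY + Z^{p^e} + T + T^{sp}).$$ Then $A$ is not isomorphic, as a $k$-algebra, to the polynomial ring $k^{[3]}$ in three variables over $k$. -/

import Mathlib

/-- The polynomial `X ^ m * Y + Z ^ (p ^ e) + T + T ^ (s * p)` in `k[X, Y, Z, T]`,
where `X, Y, Z, T` are the variables with index `0, 1, 2, 3`. -/
noncomputable def asanumaPolynomial (k : Type*) [Field k] (p m e s : ℕ) :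
    MvPolynomial (Fin 4) k :=
  MvPolynomial.X 0 ^ m * MvPolynomial.X 1 + MvPolynomial.X 2 ^ (p ^ e)
    + MvPolynomial.X 3 + MvPolynomial.X 3 ^ (s * p)

/-- The `k`-algebra `k[X, Y, Z, T] / (X ^ m * Y + Z ^ (p ^ e) + T + T ^ (s * p))`. -/
abbrev AsanumaThreefold (k : Type*) [Field k] (p m e s : ℕ) : Type _ :=
  MvPolynomial (Fin 4) k ⧸ Ideal.span {asanumaPolynomial k p m e s}

/-!
The proof follows the additive group actions on `A`, in the form of exponential maps
`φ : A → A[U]` (`IsExponential`).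

If `A` were the polynomial ring in `u₀, u₁, u₂`, then the translations of the coordinates would give
nontrivial exponential maps, each fixing the other two coordinates. View `A` inside
`k[x, x⁻¹, z, z⁻¹, t, t⁻¹]`, with `y = -(z ^ (p ^ e) + t + t ^ (s * p)) / x ^ m`. Since `y` involves
a negative power of `x`, so does some `uⱼ`. The key claim (`LaurentPresentation.eq_C_of_isExponential`)
is that an exponential map fixing an element with a negative power of `x` is trivial.

For the claim, the base field is first enlarged to be algebraically closed
(`AsanumaThreefold.nonempty_algEquiv_of_algebra`). Write `p ^ e = q * a` and `s * p = q * b` with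
`q = p ^ r` and `p ∤ b`; the two divisibility hypotheses say that `p ∣ a` and `2 ≤ b`. Give
`x, z, t` the weights `-ρ, b, a` with `ρ` irrational and large. The leading parts of the elements
of `A` form the coordinate ring of `x ^ m * y + (z ^ a + t ^ b) ^ q = 0`, whose homogeneous elements
are, because `ρ` is irrational, products of `x, y, z, t` and factors `z ^ a - κ * t ^ b`
(`exists_leadTerm`, by reduction to monomials not divisible by `x ^ m * y`). With the optimal
weight for `U`, the leading parts of `φ x, φ y, φ z, φ t` form a nontrivial deformation
`x(U), y(U), z(U), t(U)` of this threefold. It fixes `y`, since the leading part of the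
given fixed element is divisible by `y` and factors of a nonzero constant are constant. Moreover the
leading coefficients in `U` are fixed (`LaurentPresentation.hasInvariantLeadingCoeff`), hence they
are products of those among `x, y, z, t, z ^ a - κ * t ^ b` that are fixed.

Such a deformation is trivial (`IsHomogeneousDeformation.natDegree_eq_zero`):
* if some `z ^ a - κ * t ^ b` with `κ ≠ 0` is fixed (for instance if `x` is), applying `t * ∂/∂t`,
  which kills `a`-th powers, shows that `t(U) ^ (b - 1)` divides a nonzero constant;
* if exactly one of `z`, `t` is fixed and `p ∣ m`, then comparing the weights of the leading
  coefficients in the equation of the threefold gives `m * j + 1 = q * b * j'` or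
  `m * j + 1 = q * a * j'`, which is absurd modulo `p`;
* if exactly one of `z`, `t` is fixed and `p ∤ m`, then `z(U) ^ a + t(U) ^ b` is, up to a constant,
  an `m`-th power of a polynomial over the field of fractions, which is excluded by a
  Mason–Stothers argument or by the derivation `t * ∂/∂t`;
* if nothing but `y` is fixed, all leading coefficients are constants times powers of `y`, and by
  irrationality of the weight of `y` the degrees in `U` of `z(U) ^ a`, `t(U) ^ b` and every
  `z(U) ^ a - κ * t(U) ^ b` agree, although `κ` can be chosen to cancel the top terms.
-/

open Polynomial

/-! ### Leading parts with respect to a weight -/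

section Leading

variable {K G : Type*} [Field K] [AddCommGroup G] {w : G →+ ℝ} {θ : ℝ}

/-- `SuppIn w θ S P` says that every monomial `g * U ^ i` occurring in the polynomial `P` in `U` has
weight in `S`, where a group element `g` has weight `w g` and `U` has weight `θ`. -/
def SuppIn (w : G →+ ℝ) (θ : ℝ) (S : Set ℝ) (P : (AddMonoidAlgebra K G)[X]) : Prop :=
  ∀ (i : ℕ) (g : G), (P.coeff i).coeff g ≠ 0 → w g + i * θ ∈ S

theorem SuppIn.mono {S T : Set ℝ} {P : (AddMonoidAlgebra K G)[X]} (h : SuppIn w θ S P)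
    (hST : S ⊆ T) : SuppIn w θ T P := fun i g hg => hST (h i g hg)

theorem suppIn_zero (S : Set ℝ) : SuppIn w θ S (0 : (AddMonoidAlgebra K G)[X]) := by
  intro i g hg; simp at hg

theorem SuppIn.add {S : Set ℝ} {P R : (AddMonoidAlgebra K G)[X]} (hP : SuppIn w θ S P)
    (hR : SuppIn w θ S R) : SuppIn w θ S (P + R) := by
  intro i g hg
  by_cases h : (P.coeff i).coeff g = 0
  · refine hR i g fun h' => hg ?_
    simp [h, h']
  · exact hP i g h

theorem SuppIn.smul {S : Set ℝ} {P : (AddMonoidAlgebra K G)[X]} (hP : SuppIn w θ S P) (c : K) :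
    SuppIn w θ S (c • P) := by
  intro i g hg
  refine hP i g fun h => hg ?_
  simp [h]

theorem SuppIn.mul {S T V : Set ℝ} {P R : (AddMonoidAlgebra K G)[X]} (hP : SuppIn w θ S P)
    (hR : SuppIn w θ T R) (hV : ∀ s ∈ S, ∀ t ∈ T, s + t ∈ V) : SuppIn w θ V (P * R) := by
  classical
  intro n g hg
  rw [coeff_mul, AddMonoidAlgebra.coeff_sum, Finsupp.finsetSum_apply] at hg
  obtain ⟨⟨i, j⟩, hij, hne⟩ := Finset.exists_ne_zero_of_sum_ne_zero hg
  have hmem := AddMonoidAlgebra.support_coeff_mul_subset _ _ (Finsupp.mem_support_iff.mpr hne)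
  obtain ⟨g₁, h₁, g₂, h₂, rfl⟩ := Finset.mem_add.mp hmem
  have := hV _ (hP i g₁ (Finsupp.mem_support_iff.mp h₁)) _ (hR j g₂ (Finsupp.mem_support_iff.mp h₂))
  rw [← Finset.HasAntidiagonal.mem_antidiagonal.mp hij]
  convert this using 1
  push_cast [map_add]
  ring

/-- `IsLead w θ d P L` says that no monomial of `P` has weight above `d` and that `L` is the part
of `P` of weight exactly `d`; the part may vanish. -/
structure IsLead (w : G →+ ℝ) (θ d : ℝ) (P L : (AddMonoidAlgebra K G)[X]) : Prop where
  homogeneous : SuppIn w θ {d} L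
  lower : SuppIn w θ (Set.Iio d) (P - L)

namespace IsLead

variable {d e : ℝ} {P L R M : (AddMonoidAlgebra K G)[X]}

theorem suppIn (h : IsLead w θ d P L) : SuppIn w θ (Set.Iic d) P := by
  have := (h.lower.mono Set.Iio_subset_Iic_self).add
    (h.homogeneous.mono (T := Set.Iic d) (by simp))
  simpa using this

theorem zero_of_lt (h : SuppIn w θ (Set.Iio d) P) : IsLead w θ d P 0 :=
  ⟨suppIn_zero _, by simpa using h⟩

theorem coeff_eq (h : IsLead w θ d P L) {i : ℕ} {g : G} (hg : w g + i * θ = d) :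
    (L.coeff i).coeff g = (P.coeff i).coeff g := by
  by_contra hne
  have := h.lower i g (by
    rw [coeff_sub, AddMonoidAlgebra.coeff_sub, Finsupp.sub_apply, sub_ne_zero]
    exact Ne.symm hne)
  exact absurd this (by simp [hg])

theorem coeff_eq_zero (h : IsLead w θ d P L) {i : ℕ} {g : G} (hg : w g + i * θ ≠ d) :
    (L.coeff i).coeff g = 0 := by
  by_contra hne
  exact hg (h.homogeneous i g hne)

theorem of_coeff (hP : SuppIn w θ (Set.Iic d) P)
    (h₁ : ∀ (i : ℕ) g, w g + i * θ = d → (L.coeff i).coeff g = (P.coeff i).coeff g)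
    (h₂ : ∀ (i : ℕ) g, w g + i * θ ≠ d → (L.coeff i).coeff g = 0) : IsLead w θ d P L := by
  refine ⟨fun i g hg => by_contra fun h => hg (h₂ i g h), fun i g hg => ?_⟩
  rw [coeff_sub, AddMonoidAlgebra.coeff_sub, Finsupp.sub_apply] at hg
  have hne : w g + i * θ ≠ d := fun h => hg (by rw [h₁ i g h, sub_self])
  rw [h₂ i g hne, sub_zero] at hg
  exact lt_of_le_of_ne (hP i g hg) hne

theorem unique (h : IsLead w θ d P L) (h' : IsLead w θ d P M) : L = M := by
  ext i g
  by_cases hg : w g + i * θ = d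
  · rw [h.coeff_eq hg, h'.coeff_eq hg]
  · rw [h.coeff_eq_zero hg, h'.coeff_eq_zero hg]

theorem eq_zero_of_lt (h : IsLead w θ d P L) (h' : IsLead w θ e P M) (hde : d < e) : M = 0 :=
  h'.unique (zero_of_lt (h.suppIn.mono fun _ hx => lt_of_le_of_lt hx hde))

theorem degree_unique (h : IsLead w θ d P L) (h' : IsLead w θ e P M) (hL : L ≠ 0) (hM : M ≠ 0) :
    d = e := by
  rcases lt_trichotomy d e with hlt | heq | hlt
  · exact absurd (h.eq_zero_of_lt h' hlt) hM
  · exact heq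
  · exact absurd (h'.eq_zero_of_lt h hlt) hL

theorem exists_of_suppIn (h : SuppIn w θ (Set.Iic d) P) : ∃ L, IsLead w θ d P L := by
  classical
  let f : ℕ → AddMonoidAlgebra K G := fun i =>
    AddMonoidAlgebra.ofCoeff ((P.coeff i).coeff.filter fun g => w g + i * θ = d)
  have hf : ∀ i, (∑ j ∈ P.support, monomial j (f j)).coeff i = f i := by
    intro i
    rw [finsetSum_coeff]
    simp only [coeff_monomial, Finset.sum_ite_eq']
    split_ifs with hi
    · rfl
    · rw [notMem_support_iff] at hi
      ext g
      simp [f, hi, Finsupp.filter_apply]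
  refine ⟨∑ j ∈ P.support, monomial j (f j), of_coeff h (fun i g hg => ?_) fun i g hg => ?_⟩
  · rw [hf]; simp [f, hg]
  · rw [hf]; simp [f, hg]

theorem zero : IsLead w θ d (0 : (AddMonoidAlgebra K G)[X]) 0 := zero_of_lt (suppIn_zero _)

theorem add (h : IsLead w θ d P L) (h' : IsLead w θ d R M) : IsLead w θ d (P + R) (L + M) :=
  ⟨h.homogeneous.add h'.homogeneous, by
    rw [add_sub_add_comm]; exact h.lower.add h'.lower⟩

theorem smul (h : IsLead w θ d P L) (c : K) : IsLead w θ d (c • P) (c • L) :=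
  ⟨h.homogeneous.smul c, by rw [← smul_sub]; exact h.lower.smul c⟩

theorem neg (h : IsLead w θ d P L) : IsLead w θ d (-P) (-L) := by
  simpa using h.smul (-1)

theorem mul (h : IsLead w θ d P L) (h' : IsLead w θ e R M) :
    IsLead w θ (d + e) (P * R) (L * M) := by
  refine ⟨h.homogeneous.mul h'.homogeneous (by rintro _ rfl _ rfl; rfl), ?_⟩
  have : P * R - L * M = (P - L) * R + L * (R - M) := by ring
  rw [this]
  refine (h.lower.mul h'.suppIn ?_).add (h.homogeneous.mul h'.lower ?_)
  · intro s hs t ht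
    exact add_lt_add_of_lt_of_le (Set.mem_Iio.mp hs) (Set.mem_Iic.mp ht)
  · rintro s hs t ht
    exact add_lt_add_of_le_of_lt (le_of_eq hs) (Set.mem_Iio.mp ht)

theorem one : IsLead w θ 0 (1 : (AddMonoidAlgebra K G)[X]) 1 := by
  classical
  refine ⟨fun i g hg => ?_, by simpa using suppIn_zero _⟩
  rw [coeff_one] at hg
  split_ifs at hg with hi
  · rw [AddMonoidAlgebra.one_def, AddMonoidAlgebra.coeff_single, Finsupp.single_apply] at hg
    split_ifs at hg with h0
    · simp [hi, ← h0]
    · simp at hg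
  · simp at hg

theorem pow (h : IsLead w θ d P L) (n : ℕ) : IsLead w θ (n * d) (P ^ n) (L ^ n) := by
  induction n with
  | zero => simpa using one
  | succ n ih =>
    rw [pow_succ, pow_succ]
    convert ih.mul h using 1
    push_cast; ring

theorem sum {ι : Type*} (s : Finset ι) {F N : ι → (AddMonoidAlgebra K G)[X]}
    (h : ∀ i ∈ s, IsLead w θ d (F i) (N i)) : IsLead w θ d (∑ i ∈ s, F i) (∑ i ∈ s, N i) := by
  classical
  induction s using Finset.induction_on with
  | empty => simpa using zero
  | insert i s hi ih =>
    rw [Finset.sum_insert hi, Finset.sum_insert hi]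
    exact (h i (Finset.mem_insert_self i s)).add
      (ih fun j hj => h j (Finset.mem_insert_of_mem hj))

theorem of_lt (h : IsLead w θ d P L) (hde : d < e) : IsLead w θ e P 0 :=
  zero_of_lt (h.suppIn.mono fun _ hx => lt_of_le_of_lt hx hde)

theorem C_single (g : G) (c : K) :
    IsLead w θ (w g) (C (AddMonoidAlgebra.single g c)) (C (AddMonoidAlgebra.single g c)) := by
  classical
  refine ⟨fun i h hg => ?_, by simpa using suppIn_zero _⟩
  rw [coeff_C] at hg
  split_ifs at hg with hi
  · rw [AddMonoidAlgebra.coeff_single, Finsupp.single_apply] at hg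
    split_ifs at hg with h0
    · simp [hi, ← h0]
    · simp at hg
  · simp at hg

/-- The constant term of a leading part is the leading part of the constant term. -/
theorem coeff_zero_eq {r : AddMonoidAlgebra K G} (h : IsLead w θ d P L)
    (h' : IsLead w θ d (C (P.coeff 0)) (C r)) : L.coeff 0 = r := by
  ext g
  by_cases hg : w g + (0 : ℕ) * θ = d
  · rw [h.coeff_eq hg]
    simpa using (h'.coeff_eq hg).symm
  · rw [h.coeff_eq_zero hg]
    simpa using (h'.coeff_eq_zero hg).symm

end IsLead

end Leading

/-! ### Factorizations and a Mason–Stothers type statement -/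

section Algebra

/-- A binary form over an algebraically closed field splits into linear factors: the homogenization
of `f`, evaluated at `(s, t)`. -/
theorem Polynomial.sum_smul_pow_mul_pow_eq_prod {K B : Type*} [Field K] [IsAlgClosed K]
    [CommRing B] [Algebra K B] (f : K[X]) (s t : B) :
    ∑ i ∈ Finset.range (f.natDegree + 1), f.coeff i • (s ^ i * t ^ (f.natDegree - i)) =
      f.leadingCoeff • (f.roots.map fun κ => s - κ • t).prod := by
  have key : ∀ S : Multiset K, ∀ n, n = Multiset.card S →
      MvPolynomial.aeval ![s, t] (((S.map fun κ => X - C κ).prod).homogenize n) =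
        (S.map fun κ => s - κ • t).prod := by
    intro S
    induction S using Multiset.induction_on with
    | empty => rintro n rfl; simp
    | cons κ S ih =>
      rintro n rfl
      rw [Multiset.map_cons, Multiset.prod_cons, Multiset.card_cons, add_comm, homogenize_mul,
        map_mul, ih _ rfl, Multiset.map_cons, Multiset.prod_cons]
      · congr 1
        simp [Algebra.smul_def]
      · simp
      · simp
  have hf := (IsAlgClosed.splits f).eq_prod_roots
  have hcard : f.natDegree = Multiset.card f.roots := (IsAlgClosed.splits f).natDegree_eq_card_roots
  rw [← key f.roots _ hcard]
  have : f.homogenize f.natDegree =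
      MvPolynomial.C f.leadingCoeff *
        ((f.roots.map fun κ => X - C κ).prod).homogenize f.natDegree := by
    rw [← homogenize_C_mul, ← hf]
  have h2 := congrArg (MvPolynomial.aeval ![s, t]) this
  rw [map_mul, MvPolynomial.aeval_C, ← Algebra.smul_def] at h2
  rw [← h2, homogenize, map_sum, Finset.Nat.sum_antidiagonal_eq_sum_range_succ_mk]
  refine Finset.sum_congr rfl fun i _ => ?_
  rw [MvPolynomial.aeval_monomial, Algebra.smul_def, Finsupp.prod_fintype]
  · simp
  · simp

/-- A nonzero polynomial in two variables `ζ, τ` that is homogeneous for the weights `b, a`, with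
`a, b` coprime, is a product of copies of `ζ`, `τ` and `ζ ^ a - κ * τ ^ b`, with `κ ≠ 0`. -/
theorem exists_factorization_of_weighted_homogeneous.{u, v} {K : Type u} [Field K] [IsAlgClosed K]
    {I : Type*} (s : Finset I) (hs : s.Nonempty) (k l : I → ℕ) (c : I → K)
    (hc : ∀ α ∈ s, c α ≠ 0) {a b n : ℕ} (ha : 0 < a) (hab : Nat.Coprime a b)
    (hn : ∀ α ∈ s, b * k α + a * l α = n) (hinj : ∀ α ∈ s, ∀ β ∈ s, k α = k β → α = β) :
    ∃ (c₀ : K) (k₀ l₀ : ℕ) (S : Multiset K), c₀ ≠ 0 ∧ (∀ κ ∈ S, κ ≠ 0) ∧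
      b * k₀ + a * l₀ + a * b * Multiset.card S = n ∧
      ∀ {B : Type v} [CommRing B] [Algebra K B] (ζ τ : B),
        ∑ α ∈ s, c α • (ζ ^ k α * τ ^ l α) =
          c₀ • (ζ ^ k₀ * τ ^ l₀ * (S.map fun κ => ζ ^ a - κ • τ ^ b).prod) := by
  classical
  obtain ⟨α₀, h₀, hmin⟩ := s.exists_min_image k hs
  have hu : ∀ α ∈ s, ∃ u, k α = k α₀ + a * u ∧ l α + b * u = l α₀ := by
    intro α hα
    have h1 := hn α hα
    have h2 := hn α₀ h₀
    obtain ⟨v, hv⟩ := Nat.exists_eq_add_of_le (hmin α hα)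
    have hdvd : a ∣ b * v := by
      refine (Nat.dvd_add_left (dvd_mul_right a (l α))).mp ⟨l α₀, ?_⟩
      rw [hv] at h1
      linarith
    obtain ⟨u, rfl⟩ := hab.dvd_of_dvd_mul_left hdvd
    refine ⟨u, hv, ?_⟩
    rw [hv] at h1
    have : a * (l α + b * u) = a * l α₀ := by linarith
    exact Nat.eq_of_mul_eq_mul_left ha this
  choose! u hku hlu using hu
  have hu₀ : u α₀ = 0 := by
    have := hku α₀ h₀
    rcases Nat.mul_eq_zero.mp (by omega : a * u α₀ = 0) with h | h <;> omega
  have huinj : ∀ α ∈ s, ∀ β ∈ s, u α = u β → α = β := fun α hα β hβ h =>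
    hinj α hα β hβ (by rw [hku α hα, hku β hβ, h])
  let f : K[X] := ∑ α ∈ s, monomial (u α) (c α)
  have hcoeff : ∀ α ∈ s, f.coeff (u α) = c α := by
    intro α hα
    simp only [f, finsetSum_coeff, coeff_monomial]
    rw [Finset.sum_eq_single α]
    · simp
    · intro β hβ hne
      rw [if_neg fun h => hne (huinj β hβ α hα h)]
    · exact fun h => absurd hα h
  have hcoeff' : ∀ i, (∀ α ∈ s, u α ≠ i) → f.coeff i = 0 := by
    intro i hi
    simp only [f, finsetSum_coeff, coeff_monomial]
    exact Finset.sum_eq_zero fun α hα => if_neg (hi α hα)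
  have hf0 : f.coeff 0 ≠ 0 := by rw [← hu₀, hcoeff α₀ h₀]; exact hc α₀ h₀
  have hfne : f ≠ 0 := fun h => hf0 (by simp [h])
  have hle : ∀ α ∈ s, u α ≤ f.natDegree := fun α hα =>
    le_natDegree_of_ne_zero (by rw [hcoeff α hα]; exact hc α hα)
  obtain ⟨β, hβ, hβu⟩ : ∃ β ∈ s, u β = f.natDegree := by
    by_contra! h
    exact leadingCoeff_ne_zero.mpr hfne (hcoeff' _ h)
  have hcard : f.natDegree = Multiset.card f.roots := (IsAlgClosed.splits f).natDegree_eq_card_roots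
  refine ⟨f.leadingCoeff, k α₀, l β, f.roots, leadingCoeff_ne_zero.mpr hfne, ?_, ?_, ?_⟩
  · rintro κ hκ rfl
    rw [mem_roots hfne, IsRoot, ← coeff_zero_eq_eval_zero] at hκ
    exact hf0 hκ
  · rw [← hcard, ← hβu, ← hn β hβ, hku β hβ]
    ring
  · intro B _ _ ζ τ
    have hsum : ∑ α ∈ s, c α • (ζ ^ k α * τ ^ l α) = ζ ^ k α₀ * τ ^ l β *
        ∑ α ∈ s, c α • ((ζ ^ a) ^ u α * (τ ^ b) ^ (f.natDegree - u α)) := by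
      rw [Finset.mul_sum]
      refine Finset.sum_congr rfl fun α hα => ?_
      have hl : l α = l β + b * (f.natDegree - u α) := by
        have h1 := hlu α hα
        have h2 := hlu β hβ
        rw [hβu, ← Nat.add_sub_of_le (hle α hα), Nat.mul_add] at h2
        omega
      rw [hku α hα, hl, mul_smul_comm, pow_add, pow_add, pow_mul, pow_mul]
      congr 1
      ring
    have hrange : ∑ α ∈ s, c α • ((ζ ^ a) ^ u α * (τ ^ b) ^ (f.natDegree - u α)) =
        ∑ i ∈ Finset.range (f.natDegree + 1),
          f.coeff i • ((ζ ^ a) ^ i * (τ ^ b) ^ (f.natDegree - i)) := by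
      rw [← Finset.sum_subset (s₁ := s.image u), Finset.sum_image huinj]
      · exact Finset.sum_congr rfl fun α hα => by rw [hcoeff α hα]
      · intro i hi
        obtain ⟨α, hα, rfl⟩ := Finset.mem_image.mp hi
        exact Finset.mem_range_succ_iff.mpr (hle α hα)
      · intro i _ hi
        rw [hcoeff' i fun α hα h => hi (Finset.mem_image.mpr ⟨α, hα, h⟩), zero_smul]
    rw [hsum, hrange, sum_smul_pow_mul_pow_eq_prod, mul_smul_comm]

/-- Over a field, if `f ^ q = g ^ m` with `q, m` coprime, then `f` is an `m`-th power: the Bézout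
root exists in the field of rational functions and is integral over the polynomials. -/
theorem Polynomial.exists_eq_pow_of_pow_eq_pow {F : Type*} [Field F] {f g : F[X]}
    {q m : ℕ} (hqm : Nat.Coprime q m) (hm : m ≠ 0) (hf : f ≠ 0) (h : f ^ q = g ^ m) :
    ∃ H : F[X], f = H ^ m := by
  have hg : g ≠ 0 := fun h0 => by
    rw [h0, zero_pow hm] at h
    exact hf (eq_zero_of_pow_eq_zero h)
  let φ := algebraMap F[X] (FractionRing F[X])
  have hφ : Function.Injective φ := IsFractionRing.injective _ _
  have hf' : φ f ≠ 0 := fun h0 => hf (hφ (by rw [h0, map_zero]))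
  have hg' : φ g ≠ 0 := fun h0 => hg (hφ (by rw [h0, map_zero]))
  have hB : (1 : ℤ) = q * Nat.gcdA q m + m * Nat.gcdB q m := by
    rw [← Nat.gcd_eq_gcd_ab, hqm]; rfl
  have hH : φ f = (φ g ^ Nat.gcdA q m * φ f ^ Nat.gcdB q m) ^ m := by
    have h' : φ f ^ q = φ g ^ m := by rw [← map_pow, h, map_pow]
    calc φ f = φ f ^ ((q : ℤ) * Nat.gcdA q m + m * Nat.gcdB q m) := by rw [← hB, zpow_one]
      _ = (φ f ^ q) ^ Nat.gcdA q m * (φ f ^ m) ^ Nat.gcdB q m := by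
        rw [zpow_add₀ hf', zpow_mul, zpow_mul, zpow_natCast, zpow_natCast]
      _ = _ := by
        rw [h', mul_pow, ← zpow_natCast, ← zpow_natCast, ← zpow_natCast, ← zpow_natCast,
          ← zpow_mul, ← zpow_mul, ← zpow_mul, ← zpow_mul, mul_comm (m : ℤ), mul_comm (m : ℤ)]
  have hint : IsIntegral F[X] (φ g ^ Nat.gcdA q m * φ f ^ Nat.gcdB q m) := by
    refine IsIntegral.of_pow (Nat.pos_of_ne_zero hm) ?_
    rw [← hH]
    exact isIntegral_algebraMap
  obtain ⟨H, hHeq⟩ := IsIntegrallyClosed.isIntegral_iff.mp hint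
  refine ⟨H, hφ ?_⟩
  rw [map_pow, hH]
  exact congrArg (· ^ m) hHeq.symm

/-- A Mason–Stothers type statement: the curve `u * α ^ m = v + β ^ n` with `m, n ≥ 2` prime to the
characteristic has no nonconstant polynomial parametrization. -/
theorem Polynomial.natDegree_eq_zero_of_mul_pow_eq_add_pow {F : Type*} [Field F] {p : ℕ}
    [Fact p.Prime] [CharP F p] {u v : F} (hu : u ≠ 0) (hv : v ≠ 0) {m n : ℕ} (hm : 2 ≤ m)
    (hn : 2 ≤ n) (hpm : ¬ p ∣ m) (hpn : ¬ p ∣ n) :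
    ∀ (N : ℕ) (α β : F[X]), β.natDegree = N → C u * α ^ m = C v + β ^ n → N = 0 := by
  have hmF : (m : F) ≠ 0 := fun h => hpm ((CharP.cast_eq_zero_iff F p m).mp h)
  have hnF : (n : F) ≠ 0 := fun h => hpn ((CharP.cast_eq_zero_iff F p n).mp h)
  have hp : p.Prime := Fact.out
  intro N
  induction N using Nat.strong_induction_on with
  | _ N ih =>
    intro α β hβN h
    have hd := congrArg derivative h
    simp only [derivative_mul, derivative_C, derivative_add, derivative_pow, zero_mul, zero_add]
      at hd
    by_cases hβ' : derivative β = 0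
    · have hα : derivative α = 0 ∨ α = 0 := by
        rw [hβ', mul_zero] at hd
        have hCu : C u ≠ 0 := C_ne_zero.mpr hu
        have hCm : C (m : F) ≠ 0 := C_ne_zero.mpr hmF
        rcases mul_eq_zero.mp ((mul_eq_zero.mp hd).resolve_left hCu) with h1 | h1
        · exact Or.inr (eq_zero_of_pow_eq_zero (n := m - 1)
            ((mul_eq_zero.mp h1).resolve_left hCm))
        · exact Or.inl h1
      by_contra hN
      rcases hα with hα | rfl
      · -- both sides are polynomials in `X ^ p`, which may be replaced by `X`
        have e1 := expand_contract p hα hp.ne_zero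
        have e2 := expand_contract p hβ' hp.ne_zero
        have h' : C u * contract p α ^ m = C v + contract p β ^ n := by
          apply expand_injective hp.pos
          simpa [e1, e2] using h
        have hdeg : (contract p β).natDegree * p = N := by
          rw [← natDegree_expand, e2, hβN]
        have hlt : (contract p β).natDegree < N := by
          rw [← hdeg]
          refine lt_mul_of_one_lt_right (Nat.pos_of_ne_zero fun h0 => hN ?_) hp.one_lt
          rw [← hdeg, h0, zero_mul]
        have := ih _ hlt _ _ rfl h'
        rw [this, zero_mul] at hdeg
        exact hN hdeg.symm
      · have : β ^ n = C (-v) := by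
          rw [zero_pow (by omega), mul_zero] at h
          rw [C_neg]
          linear_combination -h
        have := congrArg natDegree this
        rw [natDegree_pow, natDegree_C, hβN] at this
        rcases Nat.mul_eq_zero.mp this with h0 | h0 <;> omega
    · exfalso
      have hcop : IsCoprime α β := by
        refine ⟨C (v⁻¹ * u) * α ^ (m - 1), -C v⁻¹ * β ^ (n - 1), ?_⟩
        have h1 : α ^ (m - 1) * α = α ^ m := by rw [← pow_succ]; congr 1; omega
        have h2 : β ^ (n - 1) * β = β ^ n := by rw [← pow_succ]; congr 1; omega
        have h3 : C v⁻¹ * C v = 1 := by rw [← C_mul, inv_mul_cancel₀ hv, C_1]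
        rw [C_mul]
        linear_combination C v⁻¹ * C u * h1 - C v⁻¹ * h2 + C v⁻¹ * h + h3
      have hβdeg : β.natDegree ≠ 0 := fun h0 => hβ' (by
        rw [eq_C_of_natDegree_eq_zero h0, derivative_C])
      have hd1 : α ^ (m - 1) ∣ derivative β := by
        have : α ^ (m - 1) ∣ C (n : F) * β ^ (n - 1) * derivative β :=
          ⟨C u * C (m : F) * derivative α, by rw [← hd]; ring⟩
        rw [mul_assoc] at this
        have h1 := (isUnit_C.mpr hnF.isUnit).dvd_mul_left.mp this
        exact (hcop.pow (m := m - 1) (n := n - 1)).dvd_of_dvd_mul_left h1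
      have hne : C (n : F) * β ^ (n - 1) * derivative β ≠ 0 :=
        mul_ne_zero (mul_ne_zero (C_ne_zero.mpr hnF)
          (pow_ne_zero _ fun h0 => hβ' (by rw [h0, derivative_zero]))) hβ'
      have hα' : derivative α ≠ 0 := fun h0 => hne (by rw [← hd, h0, mul_zero, mul_zero])
      have hαdeg : α.natDegree ≠ 0 := fun h0 => hα' (by
        rw [eq_C_of_natDegree_eq_zero h0, derivative_C])
      have hd2 : β ^ (n - 1) ∣ derivative α := by
        have : β ^ (n - 1) ∣ C u * (C (m : F) * α ^ (m - 1) * derivative α) :=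
          ⟨C (n : F) * derivative β, by rw [hd]; ring⟩
        rw [mul_assoc] at this
        have h1 := (isUnit_C.mpr hmF.isUnit).dvd_mul_left.mp
          ((isUnit_C.mpr hu.isUnit).dvd_mul_left.mp this)
        exact (hcop.symm.pow (m := n - 1) (n := m - 1)).dvd_of_dvd_mul_left h1
      have l1 := natDegree_le_of_dvd hd1 hβ'
      have l2 := natDegree_le_of_dvd hd2 hα'
      rw [natDegree_pow] at l1 l2
      have l3 := natDegree_derivative_lt hβdeg
      have l4 := natDegree_derivative_lt hαdeg
      have l5 : α.natDegree ≤ (m - 1) * α.natDegree := Nat.le_mul_of_pos_left _ (by omega)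
      have l6 : β.natDegree ≤ (n - 1) * β.natDegree := Nat.le_mul_of_pos_left _ (by omega)
      omega

end Algebra

/-! ### Derivations and fixed coordinates -/

section Derivations

/-- The derivation of the group algebra `K[G]` attached to an additive character `χ : G → K`: it
multiplies each group element `g` by `χ g`. -/
noncomputable def eulerDerivation {K G : Type*} [Field K] [AddCommGroup G] (χ : G →+ K) :
    Derivation K (AddMonoidAlgebra K G) (AddMonoidAlgebra K G) :=
  Derivation.mk'
    ((Finsupp.lsum K fun g => χ g • ((AddMonoidAlgebra.coeffLinearEquiv K).symm.toLinearMap ∘ₗ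
        Finsupp.lsingle g)) ∘ₗ (AddMonoidAlgebra.coeffLinearEquiv K).toLinearMap) <| by
    have hs : ∀ g c, ((Finsupp.lsum K fun g => χ g •
        ((AddMonoidAlgebra.coeffLinearEquiv K).symm.toLinearMap ∘ₗ Finsupp.lsingle g)) ∘ₗ
        (AddMonoidAlgebra.coeffLinearEquiv (S := K) (M := G) K).toLinearMap)
          (AddMonoidAlgebra.single g c) = χ g • AddMonoidAlgebra.single g c := by
      intro g c
      simp [AddMonoidAlgebra.coeffLinearEquiv]
    intro f h
    induction f using AddMonoidAlgebra.induction_linear with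
    | zero => simp
    | add f₁ f₂ h₁ h₂ => rw [add_mul, map_add, h₁, h₂, map_add, add_smul, smul_add]; abel
    | single g₁ c₁ =>
      induction h using AddMonoidAlgebra.induction_linear with
      | zero => simp
      | add f₁ f₂ h₁ h₂ => rw [mul_add, map_add, h₁, h₂, map_add, add_smul, smul_add]; abel
      | single g₂ c₂ =>
        rw [AddMonoidAlgebra.single_mul_single, hs, hs, hs, smul_eq_mul, smul_eq_mul,
          mul_smul_comm, mul_smul_comm, AddMonoidAlgebra.single_mul_single,
          AddMonoidAlgebra.single_mul_single, map_add, add_smul, add_comm g₂, mul_comm c₂, add_comm]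

theorem eulerDerivation_single {K G : Type*} [Field K] [AddCommGroup G] (χ : G →+ K) (g : G)
    (c : K) : eulerDerivation χ (AddMonoidAlgebra.single g c) =
      χ g • AddMonoidAlgebra.single g c := by
  simp [eulerDerivation, AddMonoidAlgebra.coeffLinearEquiv]

variable {K R : Type*} [Field K] [CommRing R] [Algebra K R]

/-- The coefficientwise extension of a derivation of `R` to `R[X]`. -/
noncomputable def Derivation.polynomial (D : Derivation K R R) : Derivation K R[X] R[X] :=
  PolynomialModule.equivPolynomialSelf.compDer D.mapCoeffs

theorem Derivation.coeff_polynomial (D : Derivation K R R) (f : R[X]) (i : ℕ) :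
    (D.polynomial f).coeff i = D (f.coeff i) := rfl

theorem Derivation.polynomial_C (D : Derivation K R R) (r : R) : D.polynomial (C r) = C (D r) := by
  ext i
  rw [D.coeff_polynomial, coeff_C, coeff_C]
  split_ifs <;> simp

theorem Derivation.pow_eq_zero_of_dvd {p : ℕ} [CharP K p] {B : Type*} [CommRing B]
    [Algebra K B] (D : Derivation K B B) {a : ℕ} (ha : p ∣ a) (f : B) : D (f ^ a) = 0 := by
  have : (a : K) = 0 := (CharP.cast_eq_zero_iff K p a).mpr ha
  rw [D.leibniz_pow, ← Nat.cast_smul_eq_nsmul K, this, zero_smul]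

/-- If `ζ ^ a - κ * τ ^ b` does not depend on the polynomial variable, where `p` divides `a` but
not `b`, then neither does `τ`: a derivation that does not kill `τ(0)` shows that `τ ^ (b - 1)`
divides a nonzero constant. -/
theorem natDegree_eq_zero_of_sub_smul_eq_C [IsDomain R] {p : ℕ} [CharP K p]
    (D : Derivation K R R) {ζ τ : R[X]} {a b : ℕ} {κ : K}
    (ha : p ∣ a) (hb : ¬ p ∣ b) (hb2 : 2 ≤ b) (hκ : κ ≠ 0) (ht : D (τ.coeff 0) ≠ 0)
    (h : (ζ ^ a - κ • τ ^ b).natDegree = 0) : τ.natDegree = 0 := by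
  have hbK : (b : K) ≠ 0 := fun h0 => hb ((CharP.cast_eq_zero_iff K p b).mp h0)
  have ht0 : τ.coeff 0 ≠ 0 := fun h0 => ht (by rw [h0, map_zero])
  have hD : D.polynomial (ζ ^ a - κ • τ ^ b) =
      (-(κ * b)) • (τ ^ (b - 1) * D.polynomial τ) := by
    rw [map_sub, Derivation.pow_eq_zero_of_dvd _ ha, Derivation.map_smul, Derivation.leibniz_pow,
      ← Nat.cast_smul_eq_nsmul K, zero_sub, smul_smul, neg_smul, smul_eq_mul]
  rw [eq_C_of_natDegree_eq_zero h, Derivation.polynomial_C] at hD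
  set c := D ((ζ ^ a - κ • τ ^ b).coeff 0)
  have hc0 : c = (-(κ * b)) • (τ.coeff 0 ^ (b - 1) * D (τ.coeff 0)) := by
    have := congrArg (fun f : R[X] => f.coeff 0) hD
    rw [coeff_C_zero, coeff_smul, mul_coeff_zero, D.coeff_polynomial] at this
    simpa [coeff_zero_eq_eval_zero] using this
  have hκb : -(κ * b) ≠ 0 := neg_ne_zero.mpr (mul_ne_zero hκ hbK)
  have hc : c ≠ 0 := by
    rw [hc0]
    exact smul_ne_zero hκb (mul_ne_zero (pow_ne_zero _ ht0) ht)
  have hdvd : τ ^ (b - 1) ∣ C c := by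
    rw [hD, ← mul_smul_comm]
    exact dvd_mul_right _ _
  have := natDegree_le_of_dvd hdvd (C_ne_zero.mpr hc)
  rw [natDegree_C, natDegree_pow] at this
  rcases Nat.mul_eq_zero.mp (Nat.le_zero.mp this) with h0 | h0 <;> omega

/-- If `P ^ q` is a coprime power `ξ ^ m` up to constants, then `P` is an `m`-th power up to
constants. -/
theorem exists_mul_C_pow_eq_C_mul_pow {R : Type*} [CommRing R] [IsDomain R] {P ξ : R[X]}
    {x g : R} {q m : ℕ} (hqm : Nat.Coprime q m) (hm : m ≠ 0) (hP : P ≠ 0) (hx : x ≠ 0) (hg : g ≠ 0)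
    (h : P ^ q * C x ^ m = C g ^ q * ξ ^ m) :
    ∃ (c : R) (H : R[X]), c ≠ 0 ∧ P * C c ^ m = C g * H ^ m := by
  let F := FractionRing R
  let φ : R →+* F := algebraMap R F
  have hφ : Function.Injective φ := IsFractionRing.injective _ _
  have hx' : φ x ≠ 0 := (map_ne_zero_iff φ hφ).mpr hx
  have hg' : φ g ≠ 0 := (map_ne_zero_iff φ hφ).mpr hg
  have hxC : C (φ x)⁻¹ * C (φ x) = 1 := by rw [← C_mul, inv_mul_cancel₀ hx', C_1]
  have hgC : C (φ g)⁻¹ * C (φ g) = 1 := by rw [← C_mul, inv_mul_cancel₀ hg', C_1]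
  have h' : P.map φ ^ q * C (φ x) ^ m = C (φ g) ^ q * ξ.map φ ^ m := by
    simpa using congrArg (Polynomial.map φ) h
  have hpow : (C (φ g)⁻¹ * P.map φ) ^ q = (C (φ x)⁻¹ * ξ.map φ) ^ m := by
    calc (C (φ g)⁻¹ * P.map φ) ^ q
        = C (φ g)⁻¹ ^ q * P.map φ ^ q * (C (φ x)⁻¹ * C (φ x)) ^ m := by rw [hxC]; ring
      _ = C (φ g)⁻¹ ^ q * C (φ x)⁻¹ ^ m * (P.map φ ^ q * C (φ x) ^ m) := by ring
      _ = (C (φ g)⁻¹ * C (φ g)) ^ q * (C (φ x)⁻¹ * ξ.map φ) ^ m := by rw [h']; ring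
      _ = _ := by rw [hgC]; ring
  have hne : C (φ g)⁻¹ * P.map φ ≠ 0 :=
    mul_ne_zero (C_ne_zero.mpr (inv_ne_zero hg'))
      ((Polynomial.map_ne_zero_iff hφ).mpr hP)
  obtain ⟨H, hH⟩ := exists_eq_pow_of_pow_eq_pow hqm hm hne hpow
  obtain ⟨c, hc, hcH⟩ := IsLocalization.integerNormalization_spec (nonZeroDivisors R) H
  have hcH' : (IsLocalization.integerNormalization (nonZeroDivisors R) H).map φ =
      C (φ c) * H := by
    rw [show Polynomial.map φ _ = _ from hcH]
    ext i
    rw [coeff_smul, coeff_C_mul, Algebra.smul_def]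
  refine ⟨c, IsLocalization.integerNormalization (nonZeroDivisors R) H,
    nonZeroDivisors.ne_zero hc, Polynomial.map_injective φ hφ ?_⟩
  rw [Polynomial.map_mul, Polynomial.map_pow, map_C, Polynomial.map_mul, Polynomial.map_pow, map_C,
    hcH']
  calc P.map φ * C (φ c) ^ m
      = (C (φ g) * (C (φ g)⁻¹ * P.map φ)) * C (φ c) ^ m := by
        rw [← mul_assoc, mul_comm (C (φ g)), hgC, one_mul]
    _ = _ := by rw [hH]; ring

/-- On the surface `x ^ m * y + (z ^ a + t ^ b) ^ q = 0` with `m` prime to `p`, a deformation that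
fixes `y` and `t` fixes `z`. -/
theorem natDegree_eq_zero_of_pow_mul_eq_of_right [IsDomain R] {p : ℕ} [CharP K p]
    (D : Derivation K R R) {ζ ξ : R[X]} {t x g : R} {a b q m : ℕ} (ha : p ∣ a) (ha0 : a ≠ 0)
    (hb : ¬ p ∣ b) (hqm : Nat.Coprime q m) (hm : 2 ≤ m) (ht : D t ≠ 0) (hx : x ≠ 0) (hg : g ≠ 0)
    (h : (ζ ^ a + C t ^ b) ^ q * C x ^ m = C g ^ q * ξ ^ m) : ζ.natDegree = 0 := by
  have hbK : (b : K) ≠ 0 := fun h0 => hb ((CharP.cast_eq_zero_iff K p b).mp h0)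
  have ht0 : t ≠ 0 := fun h0 => ht (by rw [h0, map_zero])
  have hDP : D.polynomial (ζ ^ a + C t ^ b) = C ((b : K) • (t ^ (b - 1) * D t)) := by
    rw [map_add, Derivation.pow_eq_zero_of_dvd _ ha, Derivation.leibniz_pow,
      ← Nat.cast_smul_eq_nsmul K, zero_add, Derivation.polynomial_C, smul_eq_mul, ← C_pow, ← C_mul,
      smul_C]
  have hd : (b : K) • (t ^ (b - 1) * D t) ≠ 0 :=
    smul_ne_zero hbK (mul_ne_zero (pow_ne_zero _ ht0) ht)
  set d := (b : K) • (t ^ (b - 1) * D t)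
  have hP : ζ ^ a + C t ^ b ≠ 0 := fun h0 => hd (by
    rw [h0, map_zero] at hDP
    exact C_eq_zero.mp hDP.symm)
  obtain ⟨c, H, hc, hH⟩ := exists_mul_C_pow_eq_C_mul_pow hqm (by omega) hP hx hg h
  have hdH := congrArg D.polynomial hH
  simp only [Derivation.leibniz, Derivation.leibniz_pow, hDP, Derivation.polynomial_C, smul_eq_mul]
    at hdH
  obtain ⟨n, rfl⟩ := Nat.exists_eq_add_of_le hm
  have e1 : 2 + n - 1 = n + 1 := by omega
  rw [e1] at hdH
  have hdvd : H ^ (n + 1) ∣ C (d * c ^ (n + 3)) := by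
    refine ⟨C c * (C g * ((2 + n) • D.polynomial H) + H * C (D g)) -
      (2 + n) • (C (D c) * C g * H), ?_⟩
    simp only [C_mul, C_pow, nsmul_eq_mul] at hdH hH ⊢
    linear_combination C c * hdH - ((2 + n : ℕ) : R[X]) * C (D c) * hH
  have h1 := natDegree_le_of_dvd hdvd (C_ne_zero.mpr (mul_ne_zero hd (pow_ne_zero _ hc)))
  rw [natDegree_C, natDegree_pow] at h1
  have hH0 : H.natDegree = 0 := by
    rcases Nat.mul_eq_zero.mp (Nat.le_zero.mp h1) with h0 | h0 <;> omega
  have h2 := congrArg natDegree hH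
  rw [← C_pow, ← C_pow, natDegree_mul_C (pow_ne_zero _ hc), natDegree_C_mul hg, natDegree_pow, hH0,
    mul_zero, natDegree_add_C, natDegree_pow] at h2
  exact (Nat.mul_eq_zero.mp h2).resolve_left ha0

/-- On the surface `x ^ m * y + (z ^ a + t ^ b) ^ q = 0` with `m` prime to `p`, a deformation that
fixes `y` and `z` fixes `t`. -/
theorem natDegree_eq_zero_of_pow_mul_eq_of_left {R : Type*} [CommRing R] [IsDomain R] {p : ℕ}
    [Fact p.Prime] [CharP R p] {τ ξ : R[X]} {z x g : R} {a b q m : ℕ}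
    (hb : ¬ p ∣ b) (hb2 : 2 ≤ b) (hpm : ¬ p ∣ m) (hqm : Nat.Coprime q m) (hm : 2 ≤ m)
    (hz : z ≠ 0) (hx : x ≠ 0) (hg : g ≠ 0)
    (h : (C z ^ a + τ ^ b) ^ q * C x ^ m = C g ^ q * ξ ^ m) : τ.natDegree = 0 := by
  by_cases hP : C z ^ a + τ ^ b = 0
  · have h1 := congrArg natDegree (eq_neg_of_add_eq_zero_right hP)
    rw [natDegree_neg, ← C_pow, natDegree_C, natDegree_pow] at h1
    rcases Nat.mul_eq_zero.mp h1 with h0 | h0 <;> omega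
  obtain ⟨c, H, hc, hH⟩ := exists_mul_C_pow_eq_C_mul_pow hqm (by omega) hP hx hg h
  let F := FractionRing R
  let φ : R →+* F := algebraMap R F
  have hφ : Function.Injective φ := IsFractionRing.injective _ _
  have : CharP F p := charP_of_injective_algebraMap hφ p
  have hz' : φ z ≠ 0 := (map_ne_zero_iff φ hφ).mpr hz
  have hg' : φ g ≠ 0 := (map_ne_zero_iff φ hφ).mpr hg
  have hc' : φ c ≠ 0 := (map_ne_zero_iff φ hφ).mpr hc
  have hH' : (C (φ z) ^ a + τ.map φ ^ b) * C (φ c) ^ m = C (φ g) * H.map φ ^ m := by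
    simpa using congrArg (Polynomial.map φ) hH
  have hcC : C (φ c)⁻¹ * C (φ c) = 1 := by rw [← C_mul, inv_mul_cancel₀ hc', C_1]
  refine natDegree_eq_zero_of_mul_pow_eq_add_pow (p := p) (u := φ g * (φ c)⁻¹ ^ m)
    (v := φ z ^ a) (mul_ne_zero hg' (pow_ne_zero _ (inv_ne_zero hc'))) (pow_ne_zero _ hz') hm hb2
    hpm hb _ (H.map φ) (τ.map φ) (natDegree_map_eq_of_injective hφ τ) ?_
  calc C (φ g * (φ c)⁻¹ ^ m) * H.map φ ^ m
      = C (φ c)⁻¹ ^ m * (C (φ g) * H.map φ ^ m) := by rw [C_mul, C_pow]; ring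
    _ = (C (φ c)⁻¹ * C (φ c)) ^ m * (C (φ z) ^ a + τ.map φ ^ b) := by rw [← hH']; ring
    _ = _ := by rw [hcC, C_pow]; ring

end Derivations

/-! ### Reduced monomials -/

section NormalForm

/-- The monomial `x ^ α.1 * y ^ α.2.1 * z ^ α.2.2.1 * t ^ α.2.2.2` in a quadruple
`v = (x, y, z, t)`. -/
def quadMonomial {B : Type*} [CommMonoid B] (v : Fin 4 → B) (α : ℕ × ℕ × ℕ × ℕ) : B :=
  v 0 ^ α.1 * v 1 ^ α.2.1 * (v 2 ^ α.2.2.1 * v 3 ^ α.2.2.2)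

/-- Exponents of the monomials not divisible by `x ^ m * y`. -/
def reducedExponents (m : ℕ) : Set (ℕ × ℕ × ℕ × ℕ) := {α | α.1 < m ∨ α.2.1 = 0}

/-- An algebra generated by `x, y, z, t` with `x ^ m * y` a polynomial in `z` and `t` is spanned by
the monomials not divisible by `x ^ m * y`. -/
theorem mem_span_quadMonomial {K A : Type*} [Field K] [CommRing A] [Algebra K A] {v : Fin 4 → A}
    {m n₁ n₂ : ℕ} (hm : 0 < m) (hrel : v 0 ^ m * v 1 + v 2 ^ n₁ + v 3 + v 3 ^ n₂ = 0)
    (P : MvPolynomial (Fin 4) K) :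
    MvPolynomial.aeval v P ∈ Submodule.span K (quadMonomial v '' reducedExponents m) := by
  set N := Submodule.span K (quadMonomial v '' reducedExponents m)
  have hmem : ∀ i j k l, (i < m ∨ j = 0) → v 0 ^ i * v 1 ^ j * (v 2 ^ k * v 3 ^ l) ∈ N :=
    fun i j k l h => Submodule.subset_span ⟨(i, j, k, l), h, rfl⟩
  have hstep : ∀ i j k l, (i < m ∨ j = 0) →
      v 0 ^ m * v 1 * (v 0 ^ i * v 1 ^ j * (v 2 ^ k * v 3 ^ l)) ∈ N := by
    intro i j k l h
    have e : v 0 ^ m * v 1 * (v 0 ^ i * v 1 ^ j * (v 2 ^ k * v 3 ^ l)) =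
        -(v 0 ^ i * v 1 ^ j * (v 2 ^ (n₁ + k) * v 3 ^ l) +
          v 0 ^ i * v 1 ^ j * (v 2 ^ k * v 3 ^ (l + 1)) +
          v 0 ^ i * v 1 ^ j * (v 2 ^ k * v 3 ^ (n₂ + l))) := by
      linear_combination (v 0 ^ i * v 1 ^ j * (v 2 ^ k * v 3 ^ l)) * hrel
    rw [e]
    exact N.neg_mem (N.add_mem (N.add_mem (hmem _ _ _ _ h) (hmem _ _ _ _ h)) (hmem _ _ _ _ h))
  have hmul : ∀ (i : Fin 4), ∀ f ∈ N, f * v i ∈ N := by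
    intro i f hf
    induction hf using Submodule.span_induction with
    | zero => rw [zero_mul]; exact N.zero_mem
    | add f g _ _ h₁ h₂ => rw [add_mul]; exact N.add_mem h₁ h₂
    | smul c f _ h => rw [smul_mul_assoc]; exact N.smul_mem c h
    | mem f hf =>
      obtain ⟨⟨i₀, j, k, l⟩, hα, rfl⟩ := hf
      have hα' : i₀ < m ∨ j = 0 := hα
      simp only [quadMonomial]
      fin_cases i
      · by_cases h : i₀ + 1 < m ∨ j = 0
        · convert hmem (i₀ + 1) j k l h using 1
          simp only [Fin.zero_eta]; ring
        · obtain ⟨n, rfl⟩ : ∃ n, j = n + 1 := ⟨j - 1, by omega⟩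
          have hi : m = i₀ + 1 := by omega
          convert hstep 0 n k l (Or.inl hm) using 1
          simp only [hi, Fin.zero_eta]; ring
      · by_cases h : i₀ < m
        · convert hmem i₀ (j + 1) k l (Or.inl h) using 1
          simp only [Fin.mk_one]; ring
        · obtain rfl : j = 0 := by omega
          obtain ⟨n, rfl⟩ := Nat.exists_eq_add_of_le (not_lt.mp h)
          convert hstep n 0 k l (Or.inr rfl) using 1
          simp only [Fin.mk_one]; ring
      · convert hmem i₀ j (k + 1) l hα' using 1
        simp only [Fin.reduceFinMk]; ring
      · convert hmem i₀ j k (l + 1) hα' using 1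
        simp only [Fin.reduceFinMk]; ring
  induction P using MvPolynomial.induction_on with
  | C c =>
    rw [MvPolynomial.aeval_C, Algebra.algebraMap_eq_smul_one]
    simpa using N.smul_mem c (hmem 0 0 0 0 (Or.inr rfl))
  | add P R h₁ h₂ => rw [map_add]; exact N.add_mem h₁ h₂
  | mul_X P i h => rw [map_mul, MvPolynomial.aeval_X]; exact hmul i _ h

theorem eq_of_mem_reducedExponents {m i j i' j' : ℕ} (h : i < m ∨ j = 0) (h' : i' < m ∨ j' = 0)
    (he : (m : ℤ) * j - i = m * j' - i') : i = i' ∧ j = j' := by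
  have key : j = j' := by
    rcases lt_trichotomy j j' with hlt | heq | hlt
    · exfalso
      have h1 : i' < m := by omega
      obtain ⟨n, rfl⟩ := Nat.exists_eq_add_of_lt hlt
      push_cast at he
      nlinarith [mul_nonneg (Int.natCast_nonneg m) (Int.natCast_nonneg n)]
    · exact heq
    · exfalso
      have h1 : i < m := by omega
      obtain ⟨n, rfl⟩ := Nat.exists_eq_add_of_lt hlt
      push_cast at he
      nlinarith [mul_nonneg (Int.natCast_nonneg m) (Int.natCast_nonneg n)]
  subst key
  exact ⟨by omega, rfl⟩

end NormalForm

/-! ### Leading terms -/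

section LeadTerm

/-- The data of a product
`c * x ^ i * y ^ j * z ^ k * t ^ l * ∏ κ ∈ S, (z ^ a - κ * t ^ b)` with `c` and all `κ` nonzero.
Over an algebraically closed field these are the bihomogeneous elements of the graded ring. -/
structure LeadTerm (K : Type*) [Field K] where
  i : ℕ
  j : ℕ
  k : ℕ
  l : ℕ
  c : K
  S : Multiset K
  c_ne_zero : c ≠ 0
  ne_zero_of_mem : ∀ κ ∈ S, κ ≠ 0

namespace LeadTerm

variable {K : Type*} [Field K]

/-- The value of a leading term at a quadruple `v = (x, y, z, t)`. -/
def eval {B : Type*} [CommRing B] [Algebra K B] (T : LeadTerm K) (a b : ℕ) (v : Fin 4 → B) : B :=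
  v 0 ^ T.i * v 1 ^ T.j *
    (T.c • (v 2 ^ T.k * v 3 ^ T.l * (T.S.map fun κ => v 2 ^ a - κ • v 3 ^ b).prod))

/-- The weight of a leading term when `x, z, t` have weights `-ρ, b, a` and
`y` has weight `y`. -/
noncomputable def weight (T : LeadTerm K) (a b : ℕ) (ρ y : ℝ) : ℝ :=
  T.i * -ρ + T.j * y + (b * T.k + a * T.l + a * b * Multiset.card T.S)

theorem map_eval {B B' : Type*} [CommRing B] [Algebra K B] [CommRing B'] [Algebra K B']
    (T : LeadTerm K) (a b : ℕ) (v : Fin 4 → B) (f : B →ₐ[K] B') :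
    f (T.eval a b v) = T.eval a b (f ∘ v) := by
  simp [eval, map_multiset_prod]

theorem eval_ne_zero {B : Type*} [CommRing B] [IsDomain B] [Algebra K B] (T : LeadTerm K)
    {a b : ℕ} {v : Fin 4 → B} (h : ∀ i, v i ≠ 0) (hκ : ∀ κ : K, κ ≠ 0 → v 2 ^ a - κ • v 3 ^ b ≠ 0) :
    T.eval a b v ≠ 0 := by
  refine mul_ne_zero (mul_ne_zero (pow_ne_zero _ (h 0)) (pow_ne_zero _ (h 1)))
    (smul_ne_zero T.c_ne_zero (mul_ne_zero (mul_ne_zero (pow_ne_zero _ (h 2))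
      (pow_ne_zero _ (h 3))) (Multiset.prod_ne_zero fun h0 => ?_)))
  obtain ⟨κ, hκS, h0⟩ := Multiset.mem_map.mp h0
  exact hκ κ (T.ne_zero_of_mem κ hκS) h0

/-- If a leading term is a nonzero constant, so is each of its factors. -/
theorem natDegree_eq_zero {R : Type*} [CommRing R] [IsDomain R] [Algebra K R] {T : LeadTerm K}
    {a b : ℕ} {H : Fin 4 → R[X]} {r : R} (hr : r ≠ 0) (h : C r = T.eval a b H) :
    (T.i ≠ 0 → (H 0).natDegree = 0) ∧ (T.j ≠ 0 → (H 1).natDegree = 0) ∧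
      (T.k ≠ 0 → (H 2).natDegree = 0) ∧ (T.l ≠ 0 → (H 3).natDegree = 0) ∧
      ∀ κ ∈ T.S, (H 2 ^ a - κ • H 3 ^ b).natDegree = 0 := by
  have key : ∀ f : R[X], f ∣ T.eval a b H → f.natDegree = 0 := by
    intro f hf
    rw [← h] at hf
    simpa using natDegree_le_of_dvd hf (C_ne_zero.mpr hr)
  have e : T.eval a b H = H 0 ^ T.i * (H 1 ^ T.j * (H 2 ^ T.k * (H 3 ^ T.l * (T.c •
      (T.S.map fun κ => H 2 ^ a - κ • H 3 ^ b).prod)))) := by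
    simp only [eval, mul_smul_comm]
    congr 1
    ring
  rw [e] at key
  refine ⟨fun h0 => key _ ?_, fun h0 => key _ ?_, fun h0 => key _ ?_, fun h0 => key _ ?_,
    fun κ hκ => key _ ?_⟩
  · exact (dvd_pow_self _ h0).mul_right _
  · exact ((dvd_pow_self _ h0).mul_right _).mul_left _
  · exact (((dvd_pow_self _ h0).mul_right _).mul_left _).mul_left _
  · exact ((((dvd_pow_self _ h0).mul_right _).mul_left _).mul_left _).mul_left _
  · refine (((Dvd.dvd.mul_left ?_ _).mul_left _).mul_left _).mul_left _
    exact dvd_smul_of_dvd _ (Multiset.dvd_prod (Multiset.mem_map_of_mem _ hκ))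

end LeadTerm

theorem Irrational.eq_zero_of_intCast_mul {y : ℝ} (hy : Irrational y) {n k : ℤ}
    (h : (n : ℝ) * y = k) : n = 0 := by
  by_contra hn
  refine hy ⟨(k : ℚ) / n, ?_⟩
  have : (n : ℝ) ≠ 0 := Int.cast_ne_zero.mpr hn
  push_cast
  field_simp
  linarith

/-- The top-weight part of a nonzero combination of reduced monomials is a leading term, and the
same leading term computes the top-weight part after substituting any quadruple `P` with
leading parts `H`. -/
theorem exists_leadTerm.{u, v} {K : Type u} {G : Type v} [Field K] [IsAlgClosed K] [AddCommGroup G]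
    {w : G →+ ℝ} {m a b N : ℕ} (ha : 0 < a) (hab : Nat.Coprime a b) {ρ : ℝ} (hρ : Irrational ρ)
    {c : ℕ × ℕ × ℕ × ℕ →₀ K} (hc : (c.support : Set _) ⊆ reducedExponents m) (hc0 : c ≠ 0) :
    ∃ T : LeadTerm K, ∀ (θ : ℝ) (P H : Fin 4 → (AddMonoidAlgebra K G)[X]),
      (∀ i, IsLead w θ (![-ρ, m * ρ + N, b, a] i) (P i) (H i)) →
      IsLead w θ (T.weight a b ρ (m * ρ + N)) (∑ α ∈ c.support, c α • quadMonomial P α)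
        (T.eval a b H) := by
  classical
  let W : ℕ × ℕ × ℕ × ℕ → ℝ := fun α =>
    α.1 * -ρ + α.2.1 * (m * ρ + N) + (α.2.2.1 * b + α.2.2.2 * a)
  obtain ⟨α₀, h₀, hmax⟩ := c.support.exists_max_image W (Finsupp.support_nonempty_iff.mpr hc0)
  let s := c.support.filter fun α => W α = W α₀
  have hα₀s : α₀ ∈ s := Finset.mem_filter.mpr ⟨h₀, rfl⟩
  have hs : ∀ α ∈ s, α.1 = α₀.1 ∧ α.2.1 = α₀.2.1 ∧
      b * α.2.2.1 + a * α.2.2.2 = b * α₀.2.2.1 + a * α₀.2.2.2 := by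
    intro α hα
    obtain ⟨hα1, hα2⟩ := Finset.mem_filter.mp hα
    simp only [W] at hα2
    have h1 : (((m : ℤ) * α.2.1 - α.1 - (m * α₀.2.1 - α₀.1) : ℤ) : ℝ) * ρ =
        ((N * α₀.2.1 + (α₀.2.2.1 * b + α₀.2.2.2 * a) -
          (N * α.2.1 + (α.2.2.1 * b + α.2.2.2 * a)) : ℤ) : ℝ) := by
      push_cast; linarith
    have h2 := hρ.eq_zero_of_intCast_mul h1
    obtain ⟨e1, e2⟩ := eq_of_mem_reducedExponents (hc hα1) (hc h₀) (sub_eq_zero.mp h2)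
    refine ⟨e1, e2, ?_⟩
    rw [e1, e2] at hα2
    have : ((b * α.2.2.1 + a * α.2.2.2 : ℕ) : ℝ) = ((b * α₀.2.2.1 + a * α₀.2.2.2 : ℕ) : ℝ) := by
      push_cast; linarith
    exact_mod_cast this
  obtain ⟨c₀, k₀, l₀, S, hc₀, hS, hw, hprod⟩ :=
    exists_factorization_of_weighted_homogeneous.{u, max u v} s ⟨α₀, hα₀s⟩ (fun α => α.2.2.1)
      (fun α => α.2.2.2) c (fun α hα => Finsupp.mem_support_iff.mp (Finset.mem_filter.mp hα).1)
      ha hab (fun α hα => (hs α hα).2.2) (by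
        rintro ⟨i, j, k, l⟩ hα ⟨i', j', k', l'⟩ hβ hk
        obtain ⟨e1, e2, e3⟩ := hs _ hα
        obtain ⟨f1, f2, f3⟩ := hs _ hβ
        simp only at e1 e2 e3 f1 f2 f3 hk
        subst hk
        have : a * l = a * l' := by omega
        have := Nat.eq_of_mul_eq_mul_left ha this
        simp [e1, e2, f1, f2, this])
  refine ⟨⟨α₀.1, α₀.2.1, k₀, l₀, c₀, S, hc₀, hS⟩, fun θ P H hPH => ?_⟩
  have hweight : LeadTerm.weight ⟨α₀.1, α₀.2.1, k₀, l₀, c₀, S, hc₀, hS⟩ a b ρ (m * ρ + N) =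
      W α₀ := by
    have : ((b * k₀ + a * l₀ + a * b * Multiset.card S : ℕ) : ℝ) =
        ((b * α₀.2.2.1 + a * α₀.2.2.2 : ℕ) : ℝ) := by rw [hw]
    push_cast at this
    simp only [LeadTerm.weight, W]
    linarith
  have heval : LeadTerm.eval ⟨α₀.1, α₀.2.1, k₀, l₀, c₀, S, hc₀, hS⟩ a b H =
      ∑ α ∈ c.support, if W α = W α₀ then c α • quadMonomial H α else 0 := by
    rw [← Finset.sum_filter]
    change H 0 ^ α₀.1 * H 1 ^ α₀.2.1 * _ = _
    rw [← hprod (H 2) (H 3), Finset.mul_sum]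
    refine Finset.sum_congr rfl fun α hα => ?_
    rw [quadMonomial, (hs α hα).1, (hs α hα).2.1, mul_smul_comm]
  rw [hweight, heval]
  refine IsLead.sum _ fun α hα => ?_
  have hmono : IsLead w θ (W α) (quadMonomial P α) (quadMonomial H α) := by
    have := (((hPH 0).pow α.1).mul ((hPH 1).pow α.2.1)).mul
      (((hPH 2).pow α.2.2.1).mul ((hPH 3).pow α.2.2.2))
    simpa [quadMonomial, W] using this
  split_ifs with h
  · rw [← h]; exact hmono.smul _
  · exact (hmono.smul _).of_lt (lt_of_le_of_ne (hmax α hα) h)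

end LeadTerm

/-! ### Homogeneous deformations -/

section HomogeneousDeformation

/-- The ring `K[x, x⁻¹, z, z⁻¹, t, t⁻¹]`; the triple `(i, k, l)` stands for
`x ^ i * z ^ k * t ^ l`. -/
abbrev LaurentXZT (K : Type*) [Field K] : Type _ := AddMonoidAlgebra K (ℤ × ℤ × ℤ)

/-- The leading coefficient in `U` of a polynomial `P` of weight `d` is, up to its weight, the value
of a leading term at the deformed quadruple `H`; in particular that value is constant in `U`. -/
def HasInvariantLeadingCoeff {K : Type*} [Field K] (a b : ℕ) (ρ y θ : ℝ)
    (H : Fin 4 → (LaurentXZT K)[X]) (d : ℝ) (P : (LaurentXZT K)[X]) : Prop :=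
  ∃ T : LeadTerm K, C P.leadingCoeff = T.eval a b H ∧ d - P.natDegree * θ = T.weight a b ρ y

/-- A homogeneous deformation `H = (x(U), y(U), z(U), t(U))` of the generic point of the surface
bundle `x ^ m * y + (z ^ a + t ^ b) ^ q = 0` that fixes `y` and whose leading coefficients in `U`
are again fixed. Here `x, y, z, t` have weights `-ρ, m * ρ + q * a * b, b, a` and `U` has
weight `θ`. -/
structure IsHomogeneousDeformation {K : Type*} [Field K] (m q a b : ℕ) (ρ θ : ℝ)
    (H : Fin 4 → (LaurentXZT K)[X]) : Prop where
  rel : H 0 ^ m * H 1 + (H 2 ^ a + H 3 ^ b) ^ q = 0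
  coeff_x : (H 0).coeff 0 = AddMonoidAlgebra.single (1, 0, 0) 1
  coeff_z : (H 2).coeff 0 = AddMonoidAlgebra.single (0, 1, 0) 1
  coeff_t : (H 3).coeff 0 = AddMonoidAlgebra.single (0, 0, 1) 1
  natDegree_y : (H 1).natDegree = 0
  lead_x : HasInvariantLeadingCoeff a b ρ (m * ρ + (q * a * b : ℕ)) θ H (-ρ) (H 0)
  lead_z : HasInvariantLeadingCoeff a b ρ (m * ρ + (q * a * b : ℕ)) θ H b (H 2)
  lead_t : HasInvariantLeadingCoeff a b ρ (m * ρ + (q * a * b : ℕ)) θ H a (H 3)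
  lead_sub : ∀ κ : K, κ ≠ 0 → HasInvariantLeadingCoeff a b ρ (m * ρ + (q * a * b : ℕ)) θ H
    (a * b) (H 2 ^ a - κ • H 3 ^ b)

theorem single_sub_smul_single_ne_zero {K : Type*} [Field K] {a b : ℕ} (ha : 0 < a) (κ : K) :
    (AddMonoidAlgebra.single (0, 1, 0) 1 : LaurentXZT K) ^ a -
      κ • (AddMonoidAlgebra.single (0, 0, 1) 1 : LaurentXZT K) ^ b ≠ 0 := by
  intro h
  have := congrArg (fun f : LaurentXZT K => f.coeff (0, (a : ℤ), 0)) h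
  have ha' : (0 : ℤ) ≠ a := by omega
  simp [AddMonoidAlgebra.single_pow, ha'] at this

theorem coeff_zero_pow_sub_smul_pow {K R : Type*} [Field K] [CommRing R] [Algebra K R]
    (f g : R[X]) (κ : K) (a b : ℕ) :
    (f ^ a - κ • g ^ b).coeff 0 = f.coeff 0 ^ a - κ • g.coeff 0 ^ b := by
  rw [Polynomial.coeff_sub, coeff_smul]
  simp [coeff_zero_eq_eval_zero]

namespace IsHomogeneousDeformation

variable {K : Type*} [Field K] {p m q a b : ℕ} {ρ θ : ℝ} {H : Fin 4 → (LaurentXZT K)[X]}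

theorem ne_zero (h : IsHomogeneousDeformation m q a b ρ θ H) :
    H 0 ≠ 0 ∧ H 2 ≠ 0 ∧ H 3 ≠ 0 := by
  refine ⟨fun h0 => ?_, fun h0 => ?_, fun h0 => ?_⟩
  · have := h.coeff_x
    rw [h0, coeff_zero] at this
    exact absurd this.symm (by simp)
  · have := h.coeff_z
    rw [h0, coeff_zero] at this
    exact absurd this.symm (by simp)
  · have := h.coeff_t
    rw [h0, coeff_zero] at this
    exact absurd this.symm (by simp)

theorem coeff_sub (h : IsHomogeneousDeformation m q a b ρ θ H) (κ : K) :
    (H 2 ^ a - κ • H 3 ^ b).coeff 0 = (AddMonoidAlgebra.single (0, 1, 0) 1 : LaurentXZT K) ^ a -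
      κ • (AddMonoidAlgebra.single (0, 0, 1) 1 : LaurentXZT K) ^ b := by
  rw [← h.coeff_z, ← h.coeff_t, coeff_zero_pow_sub_smul_pow]

theorem sub_ne_zero (h : IsHomogeneousDeformation m q a b ρ θ H) (ha : 0 < a) (κ : K) :
    H 2 ^ a - κ • H 3 ^ b ≠ 0 := fun h0 => by
  have := h.coeff_sub κ
  rw [h0, coeff_zero] at this
  exact single_sub_smul_single_ne_zero ha κ this.symm

theorem y_ne_zero (h : IsHomogeneousDeformation m q a b ρ θ H) (ha : 0 < a) : H 1 ≠ 0 := by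
  intro h0
  have h1 := h.rel
  rw [h0, mul_zero, zero_add] at h1
  refine h.sub_ne_zero ha (-1) ?_
  rw [neg_one_smul, sub_neg_eq_add]
  exact eq_zero_of_pow_eq_zero h1

/-- If `z` and `t` are fixed, so is `x`. -/
theorem natDegree_x (h : IsHomogeneousDeformation m q a b ρ θ H) (ha : 0 < a) (hm : m ≠ 0)
    (h2 : (H 2).natDegree = 0) (h3 : (H 3).natDegree = 0) : (H 0).natDegree = 0 := by
  have h1 := congrArg natDegree (eq_neg_of_add_eq_zero_left h.rel)
  rw [natDegree_mul (pow_ne_zero _ h.ne_zero.1) (h.y_ne_zero ha), natDegree_pow, h.natDegree_y,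
    natDegree_neg, natDegree_pow, eq_C_of_natDegree_eq_zero h2, eq_C_of_natDegree_eq_zero h3,
    ← C_pow, ← C_pow, ← C_add, natDegree_C, mul_zero, add_zero] at h1
  exact (Nat.mul_eq_zero.mp h1).resolve_left hm

/-- The derivation `t * ∂/∂t`. -/
noncomputable def derivationT (K : Type*) [Field K] :
    Derivation K (LaurentXZT K) (LaurentXZT K) :=
  eulerDerivation ((Int.castAddHom K).comp
    ((AddMonoidHom.snd ℤ ℤ).comp (AddMonoidHom.snd ℤ (ℤ × ℤ))))

theorem derivationT_t : derivationT K (AddMonoidAlgebra.single (0, 0, 1) 1) =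
    AddMonoidAlgebra.single (0, 0, 1) 1 := by
  rw [derivationT, eulerDerivation_single]
  simp

theorem derivationT_coeff_ne_zero (h : IsHomogeneousDeformation m q a b ρ θ H) :
    derivationT K ((H 3).coeff 0) ≠ 0 := by
  rw [h.coeff_t, derivationT_t]
  simp

variable [CharP K p]

/-- If some `z ^ a - κ * t ^ b` with `κ ≠ 0` is fixed, so are `z` and `t`. -/
theorem natDegree_of_sub (h : IsHomogeneousDeformation m q a b ρ θ H) (ha : 0 < a) (hpa : p ∣ a)
    (hpb : ¬ p ∣ b) (hb : 2 ≤ b) {κ : K} (hκ : κ ≠ 0)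
    (h0 : (H 2 ^ a - κ • H 3 ^ b).natDegree = 0) :
    (H 2).natDegree = 0 ∧ (H 3).natDegree = 0 := by
  have h3 := natDegree_eq_zero_of_sub_smul_eq_C (derivationT K) hpa hpb hb hκ
    h.derivationT_coeff_ne_zero h0
  refine ⟨?_, h3⟩
  rw [eq_C_of_natDegree_eq_zero h3, ← C_pow, smul_C, natDegree_sub_C, natDegree_pow] at h0
  exact (Nat.mul_eq_zero.mp h0).resolve_left ha.ne'

/-- If `x` is fixed, so are `z` and `t`. -/
theorem natDegree_of_x (h : IsHomogeneousDeformation m q a b ρ θ H) (ha : 0 < a) (hpa : p ∣ a)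
    (hpb : ¬ p ∣ b) (hb : 2 ≤ b) (hq : q ≠ 0) (h0 : (H 0).natDegree = 0) :
    (H 2).natDegree = 0 ∧ (H 3).natDegree = 0 := by
  refine h.natDegree_of_sub (p := p) ha hpa hpb hb (κ := -1) (by simp) ?_
  rw [neg_one_smul, sub_neg_eq_add]
  have h1 := congrArg natDegree (eq_neg_of_add_eq_zero_right h.rel)
  rw [natDegree_pow, natDegree_neg, eq_C_of_natDegree_eq_zero h0,
    eq_C_of_natDegree_eq_zero h.natDegree_y, ← C_pow, ← C_mul, natDegree_C] at h1
  exact (Nat.mul_eq_zero.mp h1).resolve_left hq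

/-- The relation with `y` eliminated, using that `y` is fixed. -/
theorem pow_mul_eq (h : IsHomogeneousDeformation m q a b ρ θ H) :
    (H 2 ^ a + H 3 ^ b) ^ q * C (AddMonoidAlgebra.single (1, 0, 0) 1) ^ m =
      C ((AddMonoidAlgebra.single (0, 1, 0) 1) ^ a + (AddMonoidAlgebra.single (0, 0, 1) 1) ^ b) ^ q
        * H 0 ^ m := by
  have h1 := eq_C_of_natDegree_eq_zero h.natDegree_y
  have h2 := congrArg (fun f => C (f.coeff 0)) h.rel
  simp only [coeff_zero_eq_eval_zero, eval_add, eval_mul, eval_pow, eval_zero, C_add, C_mul, C_pow,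
    C_0] at h2
  rw [← coeff_zero_eq_eval_zero, ← coeff_zero_eq_eval_zero, ← coeff_zero_eq_eval_zero,
    ← coeff_zero_eq_eval_zero, h.coeff_x, h.coeff_z, h.coeff_t, ← h1] at h2
  simp only [C_add, C_pow]
  linear_combination C (AddMonoidAlgebra.single (1, 0, 0) 1) ^ m * h.rel - H 0 ^ m * h2

/-- Comparison of the weights of the leading coefficients of `x(U)` and of the coordinate
`w ∈ {z, t}` that moves, when the other coordinate is fixed. -/
theorem not_dvd_of_weights {n : ℕ} {w : ℝ} {N₀ N c c' j j' e : ℕ} (hρ : Irrational ρ)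
    (hm : 0 < m) (hw : (e : ℝ) * w = (q * a * b : ℕ)) (hdeg : m * N₀ = e * N)
    (h₀ : -ρ - N₀ * θ = j * (m * ρ + (q * a * b : ℕ)) + c)
    (h₁ : w - N * θ = j' * (m * ρ + (q * a * b : ℕ)) + c') (hpe : n ∣ e) (hn : n ≠ 1) :
    ¬ n ∣ m := by
  intro hpm
  have hdeg' : (m : ℝ) * N₀ = e * N := by exact_mod_cast hdeg
  have key : (((m : ℤ) * (m * j + 1 - e * j') : ℤ) : ℝ) * ρ =
      ((e * (c' : ℤ) - m * c - (q * a * b : ℕ) * (m * j + 1 - e * j') : ℤ) : ℝ) := by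
    push_cast at h₀ h₁ hw ⊢
    linear_combination -(m : ℝ) * h₀ + e * h₁ - θ * hdeg' - hw
  have h1 := hρ.eq_zero_of_intCast_mul key
  rcases mul_eq_zero.mp h1 with h0 | h0
  · omega
  · have : m * j + 1 = e * j' := by zify; linarith
    refine hn (Nat.dvd_one.mp ?_)
    exact (Nat.dvd_add_right (hpm.mul_right j)).mp (this ▸ hpe.mul_right j')

/-- Bihomogeneity: two polynomials of the same weight whose leading coefficients are constants
times powers of `y` have the same degree. -/
theorem eq_of_weights {y : ℝ} (hy : Irrational y) {n : ℕ} (hn : n ≠ 0) {N N' s s' : ℕ}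
    (h : (n : ℝ) - N * θ = s * y) (h' : (n : ℝ) - N' * θ = s' * y) : N = N' ∧ s = s' := by
  have key : (((N' : ℤ) * s - N * s' : ℤ) : ℝ) * y = (((N' : ℤ) - N) * n : ℤ) := by
    push_cast
    linear_combination -(N' : ℝ) * h + N * h'
  have h1 := hy.eq_zero_of_intCast_mul key
  rw [h1, Int.cast_zero, zero_mul, eq_comm, Int.cast_eq_zero, mul_eq_zero] at key
  have hN : N = N' := by omega
  subst hN
  have : (((s : ℤ) - s' : ℤ) : ℝ) * y = (0 : ℤ) := by
    push_cast; linear_combination h' - h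
  exact ⟨rfl, by have := hy.eq_zero_of_intCast_mul this; omega⟩

/-- A homogeneous deformation of the surface bundle fixing `y` is trivial. -/
theorem natDegree_eq_zero [Fact p.Prime] (h : IsHomogeneousDeformation m q a b ρ θ H)
    (hρ : Irrational ρ) (hm : 2 ≤ m) (hq : q ≠ 0) (hpq : p ∣ q)
    (hqm : ¬ p ∣ m → Nat.Coprime q m) (ha : 0 < a) (hpa : p ∣ a) (hpb : ¬ p ∣ b) (hb : 2 ≤ b) :
    ∀ i, (H i).natDegree = 0 := by
  have hp1 : p ≠ 1 := (Fact.out : p.Prime).ne_one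
  suffices h23 : (H 2).natDegree = 0 ∧ (H 3).natDegree = 0 by
    intro i
    fin_cases i
    · exact h.natDegree_x ha (by omega) h23.1 h23.2
    · exact h.natDegree_y
    · exact h23.1
    · exact h23.2
  have hx := (h.natDegree_of_x (p := p) ha hpa hpb hb hq)
  have hs := fun (κ : K) (hκ : κ ≠ 0) => h.natDegree_of_sub (p := p) ha hpa hpb hb hκ
  by_contra hcon
  have h0 : (H 0).natDegree ≠ 0 := fun h0 => hcon (hx h0)
  have hs' : ∀ κ : K, κ ≠ 0 → (H 2 ^ a - κ • H 3 ^ b).natDegree ≠ 0 :=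
    fun κ hκ h0 => hcon (hs κ hκ h0)
  obtain ⟨hne0, hne2, hne3⟩ := h.ne_zero
  -- the leading coefficients only involve the fixed ones among `y`, `z`, `t`
  have hT : ∀ P : (LaurentXZT K)[X], P ≠ 0 → ∀ T : LeadTerm K,
      C P.leadingCoeff = T.eval a b H → T.i = 0 ∧ T.S = 0 ∧
        ((H 2).natDegree ≠ 0 → T.k = 0) ∧ ((H 3).natDegree ≠ 0 → T.l = 0) := by
    intro P hP T hPT
    obtain ⟨f1, -, f3, f4, f5⟩ := LeadTerm.natDegree_eq_zero (leadingCoeff_ne_zero.mpr hP) hPT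
    refine ⟨by_contra fun h => h0 (f1 h), ?_, fun h => by_contra fun h' => h (f3 h'),
      fun h => by_contra fun h' => h (f4 h')⟩
    rw [Multiset.eq_zero_iff_forall_notMem]
    intro κ hκ
    exact hs' κ (T.ne_zero_of_mem κ hκ) (f5 κ hκ)
  have hdegx : m * (H 0).natDegree = q * (H 2 ^ a + H 3 ^ b).natDegree := by
    have h1 := congrArg natDegree (eq_neg_of_add_eq_zero_left h.rel)
    rwa [natDegree_mul (pow_ne_zero _ hne0) (h.y_ne_zero ha), natDegree_pow, h.natDegree_y,
      natDegree_neg, natDegree_pow, add_zero] at h1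
  have hg : (AddMonoidAlgebra.single (0, 1, 0) 1 : LaurentXZT K) ^ a +
      (AddMonoidAlgebra.single (0, 0, 1) 1 : LaurentXZT K) ^ b ≠ 0 := by
    simpa using single_sub_smul_single_ne_zero (K := K) (b := b) ha (-1)
  have hx0 : (AddMonoidAlgebra.single (1, 0, 0) 1 : LaurentXZT K) ≠ 0 := by simp
  have hz0 : (AddMonoidAlgebra.single (0, 1, 0) 1 : LaurentXZT K) ≠ 0 := by simp
  obtain ⟨T₀, hT₀, hw₀⟩ := h.lead_x
  obtain ⟨e1, e2, e3, e4⟩ := hT _ hne0 T₀ hT₀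
  simp only [LeadTerm.weight, e1, e2] at hw₀
  obtain ⟨T₂, hT₂, hw₂⟩ := h.lead_z
  obtain ⟨f1, f2, f3, f4⟩ := hT _ hne2 T₂ hT₂
  simp only [LeadTerm.weight, f1, f2] at hw₂
  obtain ⟨T₃, hT₃, hw₃⟩ := h.lead_t
  obtain ⟨g1, g2, g3, g4⟩ := hT _ hne3 T₃ hT₃
  simp only [LeadTerm.weight, g1, g2] at hw₃
  by_cases h2 : (H 2).natDegree = 0
  · have h3 : (H 3).natDegree ≠ 0 := fun h3 => hcon ⟨h2, h3⟩
    have h2C := eq_C_of_natDegree_eq_zero h2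
    rw [h.coeff_z] at h2C
    by_cases hpm : p ∣ m
    · rw [h2C, ← C_pow, add_comm, natDegree_add_C, natDegree_pow, ← mul_assoc] at hdegx
      refine not_dvd_of_weights (q := q) (a := a) (b := b) (θ := θ) (w := a) (c := b * T₀.k)
        (c' := b * T₃.k) (j := T₀.j) (j' := T₃.j) hρ (by omega) ?_ hdegx ?_ ?_
        (hpq.mul_right b) hp1 hpm
      · push_cast; ring
      · rw [hw₀, e4 h3]; push_cast; simp
      · rw [hw₃, g4 h3]; push_cast; simp
    · have hrel := h.pow_mul_eq
      rw [h2C] at hrel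
      have : CharP (LaurentXZT K) p :=
        charP_of_injective_algebraMap (FaithfulSMul.algebraMap_injective K (LaurentXZT K)) p
      exact h3 (natDegree_eq_zero_of_pow_mul_eq_of_left (p := p) hpb hb hpm (hqm hpm) hm hz0 hx0
        hg hrel)
  by_cases h3 : (H 3).natDegree = 0
  · have h3C := eq_C_of_natDegree_eq_zero h3
    rw [h.coeff_t] at h3C
    by_cases hpm : p ∣ m
    · rw [h3C, ← C_pow, natDegree_add_C, natDegree_pow, ← mul_assoc] at hdegx
      refine not_dvd_of_weights (q := q) (a := a) (b := b) (θ := θ) (w := b) (c := a * T₀.l)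
        (c' := a * T₂.l) (j := T₀.j) (j' := T₂.j) hρ (by omega) ?_ hdegx ?_ ?_
        (hpq.mul_right a) hp1 hpm
      · push_cast; ring
      · rw [hw₀, e3 h2]; push_cast; simp
      · rw [hw₂, f3 h2]; push_cast; simp
    · have hrel := h.pow_mul_eq
      rw [h3C] at hrel
      refine h2 (natDegree_eq_zero_of_pow_mul_eq_of_right (p := p) (derivationT K) hpa ha.ne' hpb
        (hqm hpm) hm ?_ hx0 hg hrel)
      rw [derivationT_t]
      simp
  -- now all leading coefficients are constants times powers of `y`
  set y : ℝ := m * ρ + (q * a * b : ℕ) with hy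
  have hyirr : Irrational y := (hρ.natCast_mul (by omega)).add_natCast _
  rw [f3 h2, f4 h3] at hw₂
  rw [g3 h2, g4 h3] at hw₃
  have hab : a * b ≠ 0 := Nat.mul_ne_zero ha.ne' (by omega)
  have k2 : ((a * b : ℕ) : ℝ) - (a * (H 2).natDegree : ℕ) * θ = (a * T₂.j : ℕ) * y := by
    push_cast at hw₂ ⊢; simp at hw₂; linear_combination (a : ℝ) * hw₂
  have k3 : ((a * b : ℕ) : ℝ) - (b * (H 3).natDegree : ℕ) * θ = (b * T₃.j : ℕ) * y := by
    push_cast at hw₃ ⊢; simp at hw₃; linear_combination (b : ℝ) * hw₃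
  obtain ⟨hN, hj⟩ := eq_of_weights hyirr hab k2 k3
  -- choose `κ` so that the top terms in `z(U) ^ a - κ * t(U) ^ b` cancel
  set κ : K := T₂.c ^ a / T₃.c ^ b with hκ
  have hκ0 : κ ≠ 0 := div_ne_zero (pow_ne_zero _ T₂.c_ne_zero) (pow_ne_zero _ T₃.c_ne_zero)
  obtain ⟨T, hT', hw⟩ := h.lead_sub κ hκ0
  obtain ⟨i1, i2, i3, i4⟩ := hT _ (h.sub_ne_zero ha κ) T hT'
  simp only [LeadTerm.weight, i1, i2, i3 h2, i4 h3] at hw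
  have k : ((a * b : ℕ) : ℝ) - ((H 2 ^ a - κ • H 3 ^ b).natDegree : ℕ) * θ = (T.j : ℕ) * y := by
    rw [hy]; push_cast at hw ⊢; simp at hw; linear_combination hw
  obtain ⟨hN', -⟩ := eq_of_weights hyirr hab k2 k
  have hl2 : C ((H 2).leadingCoeff) = T₂.c • H 1 ^ T₂.j := by
    rw [hT₂]; simp [LeadTerm.eval, f1, f2, f3 h2, f4 h3]
  have hl3 : C ((H 3).leadingCoeff) = T₃.c • H 1 ^ T₃.j := by
    rw [hT₃]; simp [LeadTerm.eval, g1, g2, g3 h2, g4 h3]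
  have hlead : (H 2).leadingCoeff ^ a = κ • (H 3).leadingCoeff ^ b := by
    apply C_injective
    rw [← smul_C, C_pow, C_pow, hl2, hl3, _root_.smul_pow, _root_.smul_pow, ← pow_mul,
      ← pow_mul, smul_smul,
      mul_comm T₂.j, mul_comm T₃.j, hj, hκ, div_mul_cancel₀ _ (pow_ne_zero _ T₃.c_ne_zero)]
  have hcoeff : (H 2 ^ a - κ • H 3 ^ b).coeff (a * (H 2).natDegree) = 0 := by
    rw [Polynomial.coeff_sub, coeff_smul, coeff_pow_mul_natDegree, hN, coeff_pow_mul_natDegree,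
      hlead, sub_self]
  rw [hN'] at hcoeff
  exact h.sub_ne_zero ha κ (leadingCoeff_eq_zero.mp hcoeff)

end IsHomogeneousDeformation

end HomogeneousDeformation

/-! ### Homogenization of exponential maps -/

section Homogenization

theorem IsLead.multiset_prod {K G I : Type*} [Field K] [AddCommGroup G] {w : G →+ ℝ} {θ d : ℝ}
    (S : Multiset I) {F N : I → (AddMonoidAlgebra K G)[X]} (h : ∀ i ∈ S, IsLead w θ d (F i) (N i)) :
    IsLead w θ (Multiset.card S * d) (S.map F).prod (S.map N).prod := by
  induction S using Multiset.induction_on with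
  | empty => simpa using IsLead.one
  | cons i S ih =>
    rw [Multiset.map_cons, Multiset.prod_cons, Multiset.map_cons, Multiset.prod_cons,
      Multiset.card_cons]
    convert (h i (Multiset.mem_cons_self i S)).mul
      (ih fun j hj => h j (Multiset.mem_cons_of_mem hj)) using 1
    push_cast; ring

/-- The optimal weight `θ` of `U`: all `P i` have weight at most `d i`, and some leading part
still involves `U`. -/
theorem exists_weight_of_natDegree_ne_zero {K G I : Type*} [Field K] [AddCommGroup G] [Fintype I]
    {w : G →+ ℝ} {d : I → ℝ} {P : I → (AddMonoidAlgebra K G)[X]}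
    (h₀ : ∀ i g, ((P i).coeff 0).coeff g ≠ 0 → w g ≤ d i) (hP : ∃ i, (P i).natDegree ≠ 0) :
    ∃ θ : ℝ, (∀ i, SuppIn w θ (Set.Iic (d i)) (P i)) ∧
      ∀ L : I → (AddMonoidAlgebra K G)[X], (∀ i, IsLead w θ (d i) (P i) (L i)) →
        ∃ i, (L i).natDegree ≠ 0 := by
  classical
  let s : Finset ((_ : I) × (_ : ℕ) × G) := Finset.univ.sigma fun i =>
    ((P i).support.filter fun n => n ≠ 0).sigma fun n => ((P i).coeff n).coeff.support
  have hs : ∀ i n g, n ≠ 0 → ((P i).coeff n).coeff g ≠ 0 → ⟨i, n, g⟩ ∈ s := by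
    intro i n g hn hg
    simp only [s, Finset.mem_sigma, Finset.mem_univ, Finset.mem_filter, mem_support_iff,
      Finsupp.mem_support_iff, true_and]
    exact ⟨⟨fun h => hg (by rw [h]; rfl), hn⟩, hg⟩
  have hne : s.Nonempty := by
    obtain ⟨i, hi⟩ := hP
    have h1 : (P i).leadingCoeff ≠ 0 := leadingCoeff_ne_zero.mpr fun h => hi (by simp [h])
    obtain ⟨g, hg⟩ : ∃ g, (P i).leadingCoeff.coeff g ≠ 0 := by
      by_contra! h
      exact h1 (by ext g; simpa using h g)
    exact ⟨_, hs i _ g hi hg⟩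
  obtain ⟨⟨i₀, n₀, g₀⟩, hm₀, hmin⟩ := s.exists_min_image
    (fun τ => (d τ.1 - w τ.2.2) / (τ.2.1 : ℝ)) hne
  obtain ⟨⟨-, hn₀⟩, hg₀⟩ : ((P i₀).coeff n₀ ≠ 0 ∧ n₀ ≠ 0) ∧ ((P i₀).coeff n₀).coeff g₀ ≠ 0 := by
    simpa [s] using hm₀
  have hn₀' : (0 : ℝ) < n₀ := by exact_mod_cast Nat.pos_of_ne_zero hn₀
  refine ⟨(d i₀ - w g₀) / n₀, fun i n g hg => ?_, fun L hL => ⟨i₀, fun h => ?_⟩⟩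
  · rw [Set.mem_Iic]
    rcases Nat.eq_zero_or_pos n with rfl | hn
    · simpa using h₀ i g hg
    · have hn' : (0 : ℝ) < n := by exact_mod_cast hn
      have h1 : (d i₀ - w g₀) / n₀ ≤ (d i - w g) / n := hmin _ (hs i n g hn.ne' hg)
      rw [le_div_iff₀ hn'] at h1
      linarith
  · have h1 := (hL i₀).coeff_eq (i := n₀) (g := g₀) (by field_simp; ring)
    rw [coeff_eq_zero_of_natDegree_lt (by omega)] at h1
    exact hg₀ h1.symm

/-- The axioms of an action of the additive group scheme: `φ` is the identity at `U = 0`, and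
`φ_U ∘ φ_V = φ_{U + V}`, written out for the coefficients. -/
structure IsExponential {K A : Type*} [Field K] [CommRing A] [Algebra K A] (φ : A →ₐ[K] A[X]) :
    Prop where
  coeff_zero : ∀ f, (φ f).coeff 0 = f
  coeff_coeff : ∀ f i j, (φ ((φ f).coeff i)).coeff j = (i + j).choose i • (φ f).coeff (i + j)

/-- The weight on exponents of monomials in which `x, z, t` have weights `-ρ, b, a`. -/
noncomputable def xztWeight (ρ : ℝ) (a b : ℕ) : ℤ × ℤ × ℤ →+ ℝ where
  toFun g := -ρ * g.1 + b * g.2.1 + a * g.2.2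
  map_zero' := by simp
  map_add' g h := by push_cast [Prod.fst_add, Prod.snd_add]; ring

/-- A presentation of `A` as the coordinate ring of `x ^ m * y + z ^ (q * a) + t + t ^ (q * b) = 0`
together with its embedding into the Laurent polynomials in `x, z, t`. -/
structure LaurentPresentation (K A : Type*) [Field K] [CommRing A] [Algebra K A]
    (m q a b : ℕ) where
  gen : Fin 4 → A
  toLaurent : A →ₐ[K] LaurentXZT K
  exists_aeval : ∀ f : A, ∃ P : MvPolynomial (Fin 4) K, MvPolynomial.aeval gen P = f
  rel : gen 0 ^ m * gen 1 + gen 2 ^ (q * a) + gen 3 + gen 3 ^ (q * b) = 0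
  toLaurent_x : toLaurent (gen 0) = AddMonoidAlgebra.single (1, 0, 0) 1
  toLaurent_z : toLaurent (gen 2) = AddMonoidAlgebra.single (0, 1, 0) 1
  toLaurent_t : toLaurent (gen 3) = AddMonoidAlgebra.single (0, 0, 1) 1

/-- The generators `x, y, z, t` of the associated graded ring. -/
noncomputable def gradedGen (K : Type*) [Field K] (m q a b : ℕ) : Fin 4 → LaurentXZT K :=
  ![AddMonoidAlgebra.single (1, 0, 0) 1,
    AddMonoidAlgebra.single (-(m : ℤ), 0, 0) 1 * -((AddMonoidAlgebra.single (0, 1, 0) 1) ^ (q * a) +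
      (AddMonoidAlgebra.single (0, 0, 1) 1) ^ (q * b)),
    AddMonoidAlgebra.single (0, 1, 0) 1, AddMonoidAlgebra.single (0, 0, 1) 1]

/-- The weights of `x, y, z, t`. -/
noncomputable def genWeight (ρ : ℝ) (m q a b : ℕ) : Fin 4 → ℝ :=
  ![-ρ, m * ρ + (q * a * b : ℕ), b, a]

theorem gradedGen_ne_zero {K : Type*} [Field K] {m q a b : ℕ} (hqa : 0 < q * a) (i : Fin 4) :
    gradedGen K m q a b i ≠ 0 := by
  fin_cases i
  · simp [gradedGen]
  · refine mul_ne_zero (by simp) (neg_ne_zero.mpr ?_)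
    simpa using single_sub_smul_single_ne_zero (K := K) (a := q * a) (b := q * b) hqa (-1)
  · simp [gradedGen]
  · simp [gradedGen]

namespace LaurentPresentation

variable {K A : Type*} [Field K] [CommRing A] [Algebra K A] {m q a b : ℕ}
  (D : LaurentPresentation K A m q a b)

theorem toLaurent_y : D.toLaurent (D.gen 1) = AddMonoidAlgebra.single (-(m : ℤ), 0, 0) 1 *
    -((AddMonoidAlgebra.single (0, 1, 0) 1) ^ (q * a) + AddMonoidAlgebra.single (0, 0, 1) 1 +
      (AddMonoidAlgebra.single (0, 0, 1) 1) ^ (q * b)) := by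
  have h := congrArg D.toLaurent D.rel
  simp only [map_add, map_mul, map_pow, D.toLaurent_x, D.toLaurent_z, D.toLaurent_t, map_zero] at h
  have h1 : (AddMonoidAlgebra.single (-(m : ℤ), 0, 0) 1 : LaurentXZT K) *
      (AddMonoidAlgebra.single (1, 0, 0) 1) ^ m = 1 := by
    rw [AddMonoidAlgebra.single_pow, AddMonoidAlgebra.single_mul_single, AddMonoidAlgebra.one_def]
    simp
    rfl
  linear_combination (AddMonoidAlgebra.single (-(m : ℤ), 0, 0) 1) * h - D.toLaurent (D.gen 1) * h1

theorem isLead_gen (hq : 0 < q) (ha : 0 < a) (hb : 2 ≤ b) (ρ θ : ℝ) (i : Fin 4) :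
    IsLead (xztWeight ρ a b) θ (genWeight ρ m q a b i) (C (D.toLaurent (D.gen i)))
      (C (gradedGen K m q a b i)) := by
  have hx := IsLead.C_single (w := xztWeight ρ a b) (θ := θ) (1, 0, 0) (1 : K)
  have hz := IsLead.C_single (w := xztWeight ρ a b) (θ := θ) (0, 1, 0) (1 : K)
  have ht := IsLead.C_single (w := xztWeight ρ a b) (θ := θ) (0, 0, 1) (1 : K)
  have hx' := IsLead.C_single (w := xztWeight ρ a b) (θ := θ) (-(m : ℤ), 0, 0) (1 : K)
  have ex : xztWeight ρ a b (1, 0, 0) = -ρ := by simp [xztWeight]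
  have ez : xztWeight ρ a b (0, 1, 0) = b := by simp [xztWeight]
  have et : xztWeight ρ a b (0, 0, 1) = a := by simp [xztWeight]
  have ex' : xztWeight ρ a b (-(m : ℤ), 0, 0) = m * ρ := by simp [xztWeight]; ring
  rw [ex] at hx
  rw [ez] at hz
  rw [et] at ht
  rw [ex'] at hx'
  fin_cases i
  · simpa [D.toLaurent_x, gradedGen, genWeight] using hx
  · have hlt : (a : ℝ) < (q * a * b : ℕ) := by
      have : a * 1 < a * (q * b) :=
        Nat.mul_lt_mul_of_pos_left (by nlinarith) ha
      have : a < q * a * b := by nlinarith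
      exact_mod_cast this
    have e1 : ((q * a : ℕ) : ℝ) * b = (q * a * b : ℕ) := by push_cast; ring
    have e2 : ((q * b : ℕ) : ℝ) * a = (q * a * b : ℕ) := by push_cast; ring
    have h1 := hz.pow (q * a)
    have h2 := ht.pow (q * b)
    rw [e1] at h1
    rw [e2] at h2
    have h3 := hx'.mul (((h1.add (ht.of_lt hlt)).add h2).neg)
    rw [add_zero, ← C_pow, ← C_pow, ← C_add, ← C_add, ← C_add, ← C_neg, ← C_neg, ← C_mul, ← C_mul,
      ← D.toLaurent_y] at h3
    exact h3
  · simpa [D.toLaurent_z, gradedGen, genWeight] using hz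
  · simpa [D.toLaurent_t, gradedGen, genWeight] using ht

theorem exists_leadTerm_algHom [IsAlgClosed K] (hm : 0 < m) (ha : 0 < a) (hab : Nat.Coprime a b)
    {ρ : ℝ} (hρ : Irrational ρ) {f : A} (hf : f ≠ 0) :
    ∃ T : LeadTerm K, ∀ (θ : ℝ) (F : A →ₐ[K] (LaurentXZT K)[X]) (H : Fin 4 → (LaurentXZT K)[X]),
      (∀ i, IsLead (xztWeight ρ a b) θ (genWeight ρ m q a b i) (F (D.gen i)) (H i)) →
      IsLead (xztWeight ρ a b) θ (T.weight a b ρ (m * ρ + (q * a * b : ℕ))) (F f)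
        (T.eval a b H) := by
  obtain ⟨P, hP⟩ := D.exists_aeval f
  have hspan := mem_span_quadMonomial hm D.rel P
  rw [hP, Finsupp.mem_span_image_iff_linearCombination] at hspan
  obtain ⟨c, hc, hcf⟩ := hspan
  have hc0 : c ≠ 0 := fun h => hf (by rw [← hcf, h, map_zero])
  obtain ⟨T, hT⟩ := exists_leadTerm (w := xztWeight ρ a b) (N := q * a * b) (m := m) ha hab hρ
    ((Finsupp.mem_supported _ _).mp hc) hc0
  refine ⟨T, fun θ F H hH => ?_⟩
  convert hT θ (F ∘ D.gen) H hH using 1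
  rw [← hcf, Finsupp.linearCombination_apply, Finsupp.sum, map_sum]
  refine Finset.sum_congr rfl fun α _ => ?_
  simp [quadMonomial]

/-- The embedding into Laurent polynomials, followed by the inclusion of constants. -/
noncomputable def toConstants : A →ₐ[K] (LaurentXZT K)[X] :=
  (IsScalarTower.toAlgHom K (LaurentXZT K) (LaurentXZT K)[X]).comp D.toLaurent

theorem toConstants_apply (f : A) : D.toConstants f = C (D.toLaurent f) := rfl

theorem eval_C_gradedGen (T : LeadTerm K) :
    T.eval a b (fun i => C (gradedGen K m q a b i)) = C (T.eval a b (gradedGen K m q a b)) :=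
  (T.map_eval a b (gradedGen K m q a b)
    (IsScalarTower.toAlgHom K (LaurentXZT K) (LaurentXZT K)[X])).symm

theorem eval_gradedGen_ne_zero (hq : 0 < q) (ha : 0 < a) (T : LeadTerm K) :
    T.eval a b (gradedGen K m q a b) ≠ 0 :=
  T.eval_ne_zero (gradedGen_ne_zero (Nat.mul_pos hq ha))
    fun κ _ => single_sub_smul_single_ne_zero ha κ

theorem toLaurent_injective [IsAlgClosed K] (hm : 0 < m) (hq : 0 < q) (ha : 0 < a) (hb : 2 ≤ b)
    (hab : Nat.Coprime a b) : Function.Injective D.toLaurent := by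
  rw [injective_iff_map_eq_zero]
  intro f hf
  by_contra hne
  obtain ⟨T, hT⟩ := D.exists_leadTerm_algHom hm ha hab irrational_sqrt_two hne
  have h := hT 0 D.toConstants _ fun i => D.isLead_gen hq ha hb _ 0 i
  rw [D.toConstants_apply, hf, C_0, eval_C_gradedGen] at h
  exact eval_gradedGen_ne_zero hq ha T (C_eq_zero.mp (h.unique IsLead.zero))

/-- If `f` involves a negative power of `x` and the weight of `x⁻¹` is large, then the leading term
of `f` is divisible by `y`. -/
theorem leadTerm_j_ne_zero (hq : 0 < q) (ha : 0 < a) {ρ B θ : ℝ} {f : A}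
    (hB : ∀ g ∈ (D.toLaurent f).coeff.support, |(b : ℝ) * g.2.1 + a * g.2.2| ≤ B) (hρ : 2 * B < ρ)
    (hneg : ∃ g ∈ (D.toLaurent f).coeff.support, g.1 < 0) {d : ℝ} {T : LeadTerm K}
    (hT : IsLead (xztWeight ρ a b) θ d (C (D.toLaurent f))
      (T.eval a b fun i => C (gradedGen K m q a b i))) : T.j ≠ 0 := by
  intro hj
  have hne := eval_gradedGen_ne_zero (m := m) (b := b) hq ha T
  -- with `j = 0` all monomials of the leading term have `x`-exponent `i`
  let w' : ℤ × ℤ × ℤ →+ ℝ := (Int.castAddHom ℝ).comp (AddMonoidHom.fst ℤ (ℤ × ℤ))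
  have hx := IsLead.C_single (w := w') (θ := 0) (1, 0, 0) (1 : K)
  have hz := IsLead.C_single (w := w') (θ := 0) (0, 1, 0) (1 : K)
  have ht := IsLead.C_single (w := w') (θ := 0) (0, 0, 1) (1 : K)
  simp only [w', AddMonoidHom.coe_comp, AddMonoidHom.coe_fst, Function.comp_apply,
    Int.coe_castAddHom, Int.cast_one, Int.cast_zero] at hx hz ht
  have hsub : ∀ κ ∈ T.S, IsLead w' 0 0
      (C (gradedGen K m q a b 2) ^ a - κ • C (gradedGen K m q a b 3) ^ b)
      (C (gradedGen K m q a b 2) ^ a - κ • C (gradedGen K m q a b 3) ^ b) := by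
    intro κ _
    have h1 := hz.pow a
    have h2 := ((ht.pow b).smul κ).neg
    rw [mul_zero] at h1 h2
    simpa [gradedGen, sub_eq_add_neg] using h1.add h2
  have hhom := ((hx.pow T.i).mul
    ((((hz.pow T.k).mul (ht.pow T.l)).mul (IsLead.multiset_prod T.S hsub)).smul T.c)).homogeneous
  have heq : C (AddMonoidAlgebra.single (1, 0, 0) 1) ^ T.i *
      (T.c • (C (AddMonoidAlgebra.single (0, 1, 0) 1) ^ T.k *
        C (AddMonoidAlgebra.single (0, 0, 1) 1) ^ T.l *
        (T.S.map fun κ => C (gradedGen K m q a b 2) ^ a -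
          κ • C (gradedGen K m q a b 3) ^ b).prod)) =
      C (T.eval a b (gradedGen K m q a b)) := by
    rw [← eval_C_gradedGen, LeadTerm.eval, hj, pow_zero, mul_one]
    rfl
  rw [heq] at hhom
  rw [eval_C_gradedGen] at hT
  obtain ⟨g, hg⟩ : ∃ g, (T.eval a b (gradedGen K m q a b)).coeff g ≠ 0 := by
    by_contra! h
    exact hne (by ext g; simpa using h g)
  have hg' : ((C (T.eval a b (gradedGen K m q a b))).coeff 0).coeff g ≠ 0 := by rwa [coeff_C_zero]
  have h1 := hhom 0 g hg'
  have h2 := hT.homogeneous 0 g hg'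
  have h3 := hT.coeff_eq (i := 0) (g := g) h2
  rw [coeff_C_zero, coeff_C_zero] at h3
  rw [h3] at hg
  obtain ⟨g₁, hg₁, hg₁neg⟩ := hneg
  have h4 := hT.suppIn 0 g₁ (by rw [coeff_C_zero]; exact Finsupp.mem_support_iff.mp hg₁)
  have hB1 := abs_le.mp (hB g₁ hg₁)
  have hB2 := abs_le.mp (hB g (Finsupp.mem_support_iff.mpr hg))
  simp only [Set.mem_singleton_iff, Set.mem_Iic, xztWeight, AddMonoidHom.coe_mk, ZeroHom.coe_mk,
    Nat.cast_zero, zero_mul, add_zero] at h2 h4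
  have h5 : (g.1 : ℝ) = T.i := by simpa [w'] using h1
  have h6 : (0 : ℝ) ≤ g.1 := by rw [h5]; positivity
  have h7 : (g₁.1 : ℝ) ≤ -1 := by exact_mod_cast Int.le_sub_one_of_lt hg₁neg
  have hB0 : 0 ≤ B := (abs_nonneg _).trans (hB g₁ hg₁)
  nlinarith

/-- Invariance of leading coefficients: if `φ` is an exponential map and `P ≠ 0` is the leading part
of `φ f`, then the leading coefficient of `P` in `U` is the value of a leading term and is fixed by
the deformation. -/
theorem hasInvariantLeadingCoeff [IsAlgClosed K] (hm : 0 < m) (ha : 0 < a)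
    (hab : Nat.Coprime a b) {ρ θ : ℝ} (hρ : Irrational ρ) {φ : A →ₐ[K] A[X]} (hφ : IsExponential φ)
    {H : Fin 4 → (LaurentXZT K)[X]}
    (hH : ∀ i, IsLead (xztWeight ρ a b) θ (genWeight ρ m q a b i)
      ((mapAlgHom D.toLaurent) (φ (D.gen i))) (H i))
    (hne : ∀ T : LeadTerm K, T.eval a b H ≠ 0) {f : A} {d : ℝ} {P : (LaurentXZT K)[X]}
    (hP : IsLead (xztWeight ρ a b) θ d ((mapAlgHom D.toLaurent) (φ f)) P) (hP0 : P ≠ 0) :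
    HasInvariantLeadingCoeff a b ρ (m * ρ + (q * a * b : ℕ)) θ H d P := by
  set N := P.natDegree
  set f' := (φ f).coeff N
  have hcoeff : ∀ j, ((mapAlgHom D.toLaurent) (φ f')).coeff j =
      ((N + j).choose N : K) • ((mapAlgHom D.toLaurent) (φ f)).coeff (N + j) := by
    intro j
    rw [coe_mapAlgHom, coeff_map, hφ.coeff_coeff, coeff_map, Nat.cast_smul_eq_nsmul]
    exact map_nsmul D.toLaurent _ _
  have hcast : ∀ (j : ℕ) g, xztWeight ρ a b g + j * θ = d - N * θ ↔
      xztWeight ρ a b g + (N + j : ℕ) * θ = d := by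
    intro j g
    push_cast
    constructor <;> intro h <;> linarith
  have hlead : IsLead (xztWeight ρ a b) θ (d - N * θ) ((mapAlgHom D.toLaurent) (φ f'))
      (C P.leadingCoeff) := by
    refine IsLead.of_coeff (fun j g hg => ?_) (fun j g hg => ?_) fun j g hg => ?_
    · rw [hcoeff, AddMonoidAlgebra.coeff_smul, Finsupp.smul_apply] at hg
      have := hP.suppIn (N + j) g (right_ne_zero_of_smul hg)
      rw [Set.mem_Iic] at this ⊢
      push_cast at this
      linarith
    · rw [hcoeff, AddMonoidAlgebra.coeff_smul, Finsupp.smul_apply,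
        ← hP.coeff_eq ((hcast j g).mp hg), coeff_C]
      split_ifs with hj
      · simp [hj, N]
      · rw [coeff_eq_zero_of_natDegree_lt (show P.natDegree < N + j by omega)]
        simp
    · rw [coeff_C]
      split_ifs with hj
      · subst hj
        exact hP.coeff_eq_zero fun h => hg ((hcast 0 g).mpr h)
      · simp
  have hC : C P.leadingCoeff ≠ 0 := C_ne_zero.mpr (leadingCoeff_ne_zero.mpr hP0)
  have hf' : f' ≠ 0 := fun h => hC (by
    rw [h, map_zero, map_zero] at hlead
    exact hlead.unique IsLead.zero)
  obtain ⟨T, hT⟩ := D.exists_leadTerm_algHom hm ha hab hρ hf'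
  have hTH := hT θ ((mapAlgHom D.toLaurent).comp φ) H hH
  have hdeg := hlead.degree_unique hTH hC (hne T)
  refine ⟨T, ?_, hdeg⟩
  rw [← hdeg] at hTH
  exact hlead.unique hTH

/-- An exponential map that fixes an element involving a negative power of `x` is trivial. -/
theorem eq_C_of_isExponential [IsAlgClosed K] {p r : ℕ} [Fact p.Prime] [CharP K p]
    (hm : 2 ≤ m) (hq : q = p ^ r) (hr : r ≠ 0) (ha : 0 < a) (hpa : p ∣ a) (hpb : ¬ p ∣ b)
    (hb : 2 ≤ b) (hab : Nat.Coprime a b) {φ : A →ₐ[K] A[X]} (hφ : IsExponential φ) {u : A}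
    (hu : φ u = C u) (hneg : ∃ g ∈ (D.toLaurent u).coeff.support, g.1 < 0) (i : Fin 4) :
    φ (D.gen i) = C (D.gen i) := by
  have hq0 : 0 < q := hq ▸ pow_pos (Fact.out : p.Prime).pos r
  have hm0 : 0 < m := by omega
  have hu0 : u ≠ 0 := by
    rintro rfl
    obtain ⟨g, hg, -⟩ := hneg
    simp at hg
  set Φ : A →ₐ[K] (LaurentXZT K)[X] := (mapAlgHom D.toLaurent).comp φ with hΦ
  have hΦ0 : ∀ f, (Φ f).coeff 0 = D.toLaurent f := by
    intro f
    simp [Φ, hφ.coeff_zero]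
  suffices h : ∀ i, (Φ (D.gen i)).natDegree = 0 by
    apply Polynomial.map_injective (D.toLaurent : A →+* LaurentXZT K)
      (D.toLaurent_injective hm0 hq0 ha hb hab)
    have h1 := eq_C_of_natDegree_eq_zero (h i)
    rw [hΦ0] at h1
    simpa [Φ] using h1
  by_contra! hcon
  obtain ⟨ρ, hρ, hρB⟩ : ∃ ρ : ℝ, Irrational ρ ∧
      2 * ∑ g ∈ (D.toLaurent u).coeff.support, |(b : ℝ) * g.2.1 + a * g.2.2| < ρ := by
    obtain ⟨ρ, hρ, h, -⟩ := exists_irrational_btwn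
      (lt_add_one (2 * ∑ g ∈ (D.toLaurent u).coeff.support, |(b : ℝ) * g.2.1 + a * g.2.2|))
    exact ⟨ρ, hρ, h⟩
  have hB := fun g hg => Finset.single_le_sum
    (f := fun g : ℤ × ℤ × ℤ => |(b : ℝ) * g.2.1 + a * g.2.2|)
    (fun g _ => abs_nonneg _) (s := (D.toLaurent u).coeff.support) (a := g) hg
  obtain ⟨θ, hθ, hθ'⟩ := exists_weight_of_natDegree_ne_zero (w := xztWeight ρ a b)
    (d := genWeight ρ m q a b) (P := fun i => Φ (D.gen i)) (fun i g hg => by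
      have := (D.isLead_gen hq0 ha hb ρ 0 i).suppIn 0 g (by rw [coeff_C_zero, ← hΦ0]; exact hg)
      simpa using this) hcon
  choose H hH using fun i => IsLead.exists_of_suppIn (hθ i)
  obtain ⟨i₀, hi₀⟩ := hθ' H hH
  have hH0 : ∀ i, (H i).coeff 0 = gradedGen K m q a b i := fun i =>
    (hH i).coeff_zero_eq (by rw [hΦ0]; exact D.isLead_gen hq0 ha hb ρ θ i)
  have hHne : ∀ i, H i ≠ 0 := fun i h0 => gradedGen_ne_zero (K := K) (m := m) (b := b)
    (Nat.mul_pos hq0 ha) i (by rw [← hH0, h0, coeff_zero])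
  have hsubne : ∀ κ : K, H 2 ^ a - κ • H 3 ^ b ≠ 0 := by
    intro κ h0
    have h1 := coeff_zero_pow_sub_smul_pow (H 2) (H 3) κ a b
    rw [h0, coeff_zero, hH0, hH0] at h1
    exact single_sub_smul_single_ne_zero ha κ h1.symm
  have hTne : ∀ T : LeadTerm K, T.eval a b H ≠ 0 := fun T =>
    T.eval_ne_zero hHne fun κ _ => hsubne κ
  have hLC := fun (f : A) (d : ℝ) (P : (LaurentXZT K)[X])
    (hP : IsLead (xztWeight ρ a b) θ d (Φ f) P) (hP0 : P ≠ 0) =>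
    D.hasInvariantLeadingCoeff hm0 ha hab hρ hφ hH hTne hP hP0
  have : CharP (LaurentXZT K)[X] p :=
    charP_of_injective_algebraMap (FaithfulSMul.algebraMap_injective K (LaurentXZT K)[X]) p
  have hdef : IsHomogeneousDeformation m q a b ρ θ H := by
    refine ⟨?_, hH0 0, hH0 2, hH0 3, ?_, hLC _ _ _ (hH 0) (hHne 0), hLC _ _ _ (hH 2) (hHne 2),
      hLC _ _ _ (hH 3) (hHne 3), fun κ _ => ?_⟩
    · have hrel := congrArg Φ D.rel
      simp only [map_add, map_mul, map_pow, map_zero] at hrel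
      have h0 : IsLead (xztWeight ρ a b) θ _ _ _ := ((hH 0).pow m).mul (hH 1)
      have h2 : IsLead (xztWeight ρ a b) θ _ _ _ := (hH 2).pow (q * a)
      have h3 : IsLead (xztWeight ρ a b) θ _ _ _ := (hH 3).pow (q * b)
      have hlt : genWeight ρ m q a b 3 < (q * a * b : ℕ) := by
        have : a < q * a * b := by
          have : a * 1 < a * (q * b) := Nat.mul_lt_mul_of_pos_left (by nlinarith) ha
          nlinarith
        simpa [genWeight] using (by exact_mod_cast this : (a : ℝ) < (q * a * b : ℕ))
      have ht := (hH 3).of_lt hlt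
      rw [show (m : ℝ) * genWeight ρ m q a b 0 + genWeight ρ m q a b 1 = (q * a * b : ℕ) by
        simp [genWeight]] at h0
      rw [show ((q * a : ℕ) : ℝ) * genWeight ρ m q a b 2 = (q * a * b : ℕ) by
        simp [genWeight]] at h2
      rw [show ((q * b : ℕ) : ℝ) * genWeight ρ m q a b 3 = (q * a * b : ℕ) by
        simp [genWeight]; ring] at h3
      have hsum := ((h0.add h2).add ht).add h3
      rw [hrel] at hsum
      have h4 := hsum.unique IsLead.zero
      rw [hq, add_pow_char_pow, ← hq, ← pow_mul, ← pow_mul, mul_comm a q, mul_comm b q]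
      linear_combination h4
    · obtain ⟨T, hT⟩ := D.exists_leadTerm_algHom hm0 ha hab hρ hu0
      have h1 := hT θ D.toConstants _ fun i => D.isLead_gen hq0 ha hb ρ θ i
      have h2 := hT θ Φ H hH
      have hΦu : Φ u = D.toConstants u := by simp [Φ, hu, D.toConstants_apply]
      rw [hΦu] at h2
      have h3 := h1.unique h2
      rw [eval_C_gradedGen] at h3
      refine (LeadTerm.natDegree_eq_zero (eval_gradedGen_ne_zero hq0 ha T) h3).2.1 ?_
      exact D.leadTerm_j_ne_zero hq0 ha hB hρB hneg h1
    · refine hLC (D.gen 2 ^ a - κ • D.gen 3 ^ b) _ _ ?_ (hsubne κ)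
      have h2 : IsLead (xztWeight ρ a b) θ _ _ _ := (hH 2).pow a
      have h3 : IsLead (xztWeight ρ a b) θ _ _ _ := (((hH 3).pow b).smul κ).neg
      rw [show (a : ℝ) * genWeight ρ m q a b 2 = a * b by simp [genWeight]] at h2
      rw [show (b : ℝ) * genWeight ρ m q a b 3 = a * b by simp [genWeight]; ring] at h3
      have h4 := h2.add h3
      rwa [← sub_eq_add_neg, ← sub_eq_add_neg, ← map_pow, ← map_pow, ← map_smul, ← map_sub] at h4
  refine hi₀ (hdef.natDegree_eq_zero (p := p) hρ hm hq0.ne' (hq ▸ dvd_pow_self p hr)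
    (fun hpm => ?_) ha hpa hpb hb i₀)
  rw [hq]
  exact ((Nat.Prime.coprime_iff_not_dvd Fact.out).mpr hpm).pow_left r

end LaurentPresentation

end Homogenization

/-! ### Translations of affine space -/

section Translations

variable {K : Type*} [Field K]

theorem coeff_coeff_aeval_X_add_C_X {S : Type*} [CommRing S] (P : S[X]) (i j : ℕ) :
    ((aeval (X + C X : S[X][X]) P).coeff i).coeff j = (i + j).choose i • P.coeff (i + j) := by
  induction P using Polynomial.induction_on' with
  | add P R h₁ h₂ => simp only [map_add, Polynomial.coeff_add, h₁, h₂, smul_add]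
  | monomial n s =>
    rw [aeval_monomial, IsScalarTower.algebraMap_apply S S[X] S[X][X], ← C_eq_algebraMap,
      ← C_eq_algebraMap, coeff_C_mul, coeff_X_add_C_pow, coeff_C_mul, coeff_mul_natCast,
      coeff_X_pow, coeff_monomial]
    by_cases h : n = i + j
    · subst h
      simp [mul_comm]
    · rw [if_neg h, smul_zero]
      by_cases hi : n < i
      · rw [Nat.choose_eq_zero_of_lt hi]; simp
      · rw [if_neg (by omega)]; simp

/-- The action of the additive group on affine space by translation of the `i`-th coordinate. -/
noncomputable def translation {σ : Type*} [DecidableEq σ] (i : σ) :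
    MvPolynomial σ K →ₐ[K] (MvPolynomial σ K)[X] :=
  MvPolynomial.aeval fun l => C (MvPolynomial.X l) + if l = i then X else 0

theorem isExponential_translation {σ : Type*} [DecidableEq σ] (i : σ) :
    IsExponential (translation (K := K) i) := by
  constructor
  · intro f
    have h : ((aeval (0 : MvPolynomial σ K)).restrictScalars K).comp (translation i) =
        AlgHom.id K (MvPolynomial σ K) := by
      ext l : 1
      by_cases h : l = i <;> simp [translation, h]
    have := DFunLike.congr_fun h f
    simpa [coeff_zero_eq_eval_zero, coe_aeval_eq_eval] using this
  · intro f j l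
    have h : (mapAlgHom (translation i)).comp (translation (K := K) i) =
        ((aeval (X + C X : (MvPolynomial σ K)[X][X])).restrictScalars K).comp (translation i) := by
      have hCC : ∀ f : MvPolynomial σ K, algebraMap (MvPolynomial σ K) (MvPolynomial σ K)[X][X] f =
        C (C f) := fun _ => rfl
      ext l : 1
      by_cases h : l = i
      · simp [translation, h, hCC]
        ring
      · simp [translation, h, hCC]
    have := congrArg (fun P => (P.coeff j).coeff l) (DFunLike.congr_fun h f)
    simp only [AlgHom.comp_apply, AlgHom.restrictScalars_apply, coeff_coeff_aeval_X_add_C_X,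
      coe_mapAlgHom, coeff_map] at this
    exact this

theorem IsExponential.conj {A B : Type*} [CommRing A] [Algebra K A] [CommRing B] [Algebra K B]
    {φ : B →ₐ[K] B[X]} (hφ : IsExponential φ) (e : A ≃ₐ[K] B) :
    IsExponential ((mapAlgHom (e.symm : B →ₐ[K] A)).comp (φ.comp (e : A →ₐ[K] B))) := by
  constructor
  · intro f
    simp [hφ.coeff_zero]
  · intro f i j
    simp [hφ.coeff_coeff]

end Translations

/-! ### The threefold over an algebraically closed field -/

section Threefold

variable {K : Type*} [Field K] {p m e s : ℕ}

/-- The presentation of the threefold, with `p ^ e = q * a` and `s * p = q * b`. -/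
noncomputable def AsanumaThreefold.laurentPresentation {q a b : ℕ} (hqa : p ^ e = q * a)
    (hqb : s * p = q * b) : LaurentPresentation K (AsanumaThreefold K p m e s) m q a b where
  gen i := Ideal.Quotient.mk _ (MvPolynomial.X i)
  toLaurent := Ideal.Quotient.liftₐ _ (MvPolynomial.aeval
    ![AddMonoidAlgebra.single (1, 0, 0) 1,
      AddMonoidAlgebra.single (-(m : ℤ), 0, 0) 1 *
        -((AddMonoidAlgebra.single (0, 1, 0) 1) ^ (q * a) + AddMonoidAlgebra.single (0, 0, 1) 1 +
          (AddMonoidAlgebra.single (0, 0, 1) 1) ^ (q * b)),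
      AddMonoidAlgebra.single (0, 1, 0) 1, AddMonoidAlgebra.single (0, 0, 1) 1]) (by
    intro f hf
    obtain ⟨g, rfl⟩ := Ideal.mem_span_singleton'.mp hf
    have h1 : (AddMonoidAlgebra.single (1, 0, 0) 1 : LaurentXZT K) ^ m *
        (AddMonoidAlgebra.single (-(m : ℤ), 0, 0) 1) = 1 := by
      rw [AddMonoidAlgebra.single_pow, AddMonoidAlgebra.single_mul_single,
        AddMonoidAlgebra.one_def]
      simp
      rfl
    rw [map_mul, asanumaPolynomial, hqa, hqb]
    refine mul_eq_zero_of_right _ ?_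
    simp only [map_add, map_mul, map_pow, MvPolynomial.aeval_X, Matrix.cons_val]
    linear_combination -((AddMonoidAlgebra.single (0, 1, 0) 1) ^ (q * a) +
      AddMonoidAlgebra.single (0, 0, 1) 1 + (AddMonoidAlgebra.single (0, 0, 1) 1) ^ (q * b)) * h1)
  exists_aeval f := by
    obtain ⟨P, rfl⟩ := Ideal.Quotient.mk_surjective f
    refine ⟨P, ?_⟩
    have : MvPolynomial.aeval (R := K) (fun i => Ideal.Quotient.mk
        (Ideal.span {asanumaPolynomial K p m e s}) (MvPolynomial.X i)) =
        Ideal.Quotient.mkₐ K (Ideal.span {asanumaPolynomial K p m e s}) := by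
      ext i : 1
      simp
    rw [this]
    rfl
  rel := by
    rw [← hqa, ← hqb]
    simp only [← map_pow, ← map_mul, ← map_add]
    exact Ideal.Quotient.eq_zero_iff_mem.mpr (Ideal.mem_span_singleton_self _)
  toLaurent_x := by
    refine Eq.trans (Ideal.Quotient.lift_mk _ _ _) ((MvPolynomial.aeval_X _ _).trans ?_)
    simp
  toLaurent_z := by
    refine Eq.trans (Ideal.Quotient.lift_mk _ _ _) ((MvPolynomial.aeval_X _ _).trans ?_)
    simp
  toLaurent_t := by
    refine Eq.trans (Ideal.Quotient.lift_mk _ _ _) ((MvPolynomial.aeval_X _ _).trans ?_)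
    simp

theorem LaurentPresentation.isEmpty_algEquiv [IsAlgClosed K] [Fact p.Prime] [CharP K p]
    {A : Type*} [CommRing A] [Algebra K A] {q a b r : ℕ} (D : LaurentPresentation K A m q a b)
    (hm : 2 ≤ m) (hq : q = p ^ r) (hr : r ≠ 0) (ha : 0 < a) (hpa : p ∣ a) (hpb : ¬ p ∣ b)
    (hb : 2 ≤ b) (hab : Nat.Coprime a b) : IsEmpty (A ≃ₐ[K] MvPolynomial (Fin 3) K) := by
  refine ⟨fun ε => ?_⟩
  have hq0 : 0 < q := hq ▸ pow_pos (Fact.out : p.Prime).pos r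
  -- some coordinate function `u` involves a negative power of `x`, since `y` does
  obtain ⟨j, hj⟩ : ∃ j, ∃ g ∈ (D.toLaurent (ε.symm (MvPolynomial.X j))).coeff.support, g.1 < 0 := by
    by_contra! hcon
    let w' : ℤ × ℤ × ℤ →+ ℝ := (Int.castAddHom ℝ).comp (AddMonoidHom.fst ℤ (ℤ × ℤ))
    have hX : ∀ j, SuppIn w' 0 (Set.Ici 0) (C (D.toLaurent (ε.symm (MvPolynomial.X j)))) := by
      intro j i g hg
      rw [coeff_C] at hg
      split_ifs at hg
      · have := hcon j g (Finsupp.mem_support_iff.mpr hg)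
        simpa [w'] using this
      · simp at hg
    have hall : ∀ P, SuppIn w' 0 (Set.Ici 0) (C (D.toLaurent (ε.symm P))) := by
      intro P
      induction P using MvPolynomial.induction_on with
      | C c =>
        have := (IsLead.C_single (w := w') (θ := 0) 0 c).homogeneous
        rw [map_zero] at this
        refine SuppIn.mono (S := {0}) ?_ (by simp)
        convert this
        rw [← MvPolynomial.algebraMap_eq, AlgEquiv.commutes, AlgHom.commutes]
        rfl
      | add P R h₁ h₂ => rw [map_add, map_add, C_add]; exact h₁.add h₂
      | mul_X P i h =>
        rw [map_mul, map_mul, C_mul]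
        exact h.mul (hX i) fun s hs t ht =>
          Set.mem_Ici.mpr (add_nonneg (Set.mem_Ici.mp hs) (Set.mem_Ici.mp ht))
    have hy := hall (ε (D.gen 1))
    rw [AlgEquiv.symm_apply_apply, D.toLaurent_y] at hy
    have := hy 0 (-(m : ℤ), (q * a : ℕ), 0) (by
      rw [coeff_C_zero]
      simp [mul_add, AddMonoidAlgebra.single_pow, AddMonoidAlgebra.single_mul_single,
        hq0.ne', ha.ne'])
    simp [w'] at this
    omega
  obtain ⟨i, hi⟩ : ∃ i : Fin 3, i ≠ j := exists_ne j
  set φ := (mapAlgHom (ε.symm : MvPolynomial (Fin 3) K →ₐ[K] A)).comp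
    ((translation i).comp (ε : A →ₐ[K] MvPolynomial (Fin 3) K))
  have hφ : IsExponential φ := (isExponential_translation i).conj ε
  have hu : φ (ε.symm (MvPolynomial.X j)) = C (ε.symm (MvPolynomial.X j)) := by
    simp [φ, translation, hi.symm]
  have htriv := D.eq_C_of_isExponential hm hq hr ha hpa hpb hb hab hφ hu hj
  have hφC : φ = IsScalarTower.toAlgHom K A A[X] := by
    ext f : 1
    obtain ⟨P, rfl⟩ := D.exists_aeval f
    have h : φ.comp (MvPolynomial.aeval D.gen) =
        (IsScalarTower.toAlgHom K A A[X]).comp (MvPolynomial.aeval D.gen) := by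
      ext l : 1
      simpa using htriv l
    exact DFunLike.congr_fun h P
  have h1 := DFunLike.congr_fun hφC (ε.symm (MvPolynomial.X i))
  have h2 : φ (ε.symm (MvPolynomial.X i)) = C (ε.symm (MvPolynomial.X i)) + X := by
    simp [φ, translation]
  rw [h2, IsScalarTower.coe_toAlgHom', ← C_eq_algebraMap, add_eq_left] at h1
  have : Nontrivial A := ε.toEquiv.nontrivial
  exact X_ne_zero h1

end Threefold

/-! ### Extension of the base field -/

section BaseChange

/-- An isomorphism of the threefold with affine space persists after extension of the
base field. -/
theorem AsanumaThreefold.nonempty_algEquiv_of_algebra {k K : Type*} [Field k] [Field K]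
    [Algebra k K] {p m e s : ℕ} {σ : Type*}
    (ε : AsanumaThreefold k p m e s ≃ₐ[k] MvPolynomial σ k) :
    Nonempty (AsanumaThreefold K p m e s ≃ₐ[K] MvPolynomial σ K) := by
  let π := Ideal.Quotient.mk (Ideal.span {asanumaPolynomial k p m e s})
  let πK := Ideal.Quotient.mk (Ideal.span {asanumaPolynomial K p m e s})
  have hpoly : MvPolynomial.map (algebraMap k K) (asanumaPolynomial k p m e s) =
      asanumaPolynomial K p m e s := by
    simp [asanumaPolynomial]
  -- the base change homomorphism between the coordinate rings
  let β : AsanumaThreefold k p m e s →+* AsanumaThreefold K p m e s :=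
    Ideal.quotientMap _ (MvPolynomial.map (algebraMap k K)) (by
      rw [Ideal.span_singleton_le_iff_mem, Ideal.mem_comap, hpoly]
      exact Ideal.mem_span_singleton_self _)
  have hβ : ∀ P, β (π P) = πK (MvPolynomial.map (algebraMap k K) P) := fun P =>
    Ideal.quotientMap_mk
  -- the forward homomorphism
  let F₀ : MvPolynomial (Fin 4) K →ₐ[K] MvPolynomial σ K :=
    MvPolynomial.aeval fun i => MvPolynomial.map (algebraMap k K) (ε (π (MvPolynomial.X i)))
  have hF₀ : ∀ P, F₀ (MvPolynomial.map (algebraMap k K) P) =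
      MvPolynomial.map (algebraMap k K) (ε (π P)) := by
    intro P
    induction P using MvPolynomial.induction_on with
    | C c =>
      have : π (MvPolynomial.C c) = algebraMap k (AsanumaThreefold k p m e s) c := rfl
      rw [this, AlgEquiv.commutes, MvPolynomial.algebraMap_eq, MvPolynomial.map_C]
      simp [F₀]
    | add P R h₁ h₂ => simp only [map_add, h₁, h₂]
    | mul_X P i h => simp only [map_mul, h, MvPolynomial.map_X]; simp [F₀]
  let F : AsanumaThreefold K p m e s →ₐ[K] MvPolynomial σ K := Ideal.Quotient.liftₐ _ F₀ (by
    intro f hf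
    obtain ⟨g, rfl⟩ := Ideal.mem_span_singleton'.mp hf
    have : π (asanumaPolynomial k p m e s) = 0 :=
      Ideal.Quotient.eq_zero_iff_mem.mpr (Ideal.mem_span_singleton_self _)
    rw [map_mul, ← hpoly, hF₀, this, map_zero, map_zero, mul_zero])
  have hF : ∀ P, F (πK P) = F₀ P := fun P => rfl
  have hFβ : ∀ f, F (β f) = MvPolynomial.map (algebraMap k K) (ε f) := by
    intro f
    obtain ⟨P, rfl⟩ := Ideal.Quotient.mk_surjective f
    rw [hβ, hF, hF₀]
  -- the backward homomorphism
  let G : MvPolynomial σ K →ₐ[K] AsanumaThreefold K p m e s :=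
    MvPolynomial.aeval fun i => β (ε.symm (MvPolynomial.X i))
  have hG : ∀ P, G (MvPolynomial.map (algebraMap k K) P) = β (ε.symm P) := by
    intro P
    induction P using MvPolynomial.induction_on with
    | C c =>
      rw [MvPolynomial.map_C, ← MvPolynomial.algebraMap_eq, ← MvPolynomial.algebraMap_eq,
        AlgHom.commutes, AlgEquiv.commutes]
      have : β (π (MvPolynomial.C c)) = πK (MvPolynomial.C (algebraMap k K c)) := by
        rw [hβ, MvPolynomial.map_C]
      exact this.symm
    | add P R h₁ h₂ => simp only [map_add, h₁, h₂]
    | mul_X P i h => simp only [map_mul, h, MvPolynomial.map_X]; simp [G]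
  refine ⟨AlgEquiv.ofAlgHom F G ?_ ?_⟩
  · ext i : 1
    have : G (MvPolynomial.X i) = β (ε.symm (MvPolynomial.X i)) := by simp [G]
    rw [AlgHom.comp_apply, this, hFβ, AlgEquiv.apply_symm_apply, MvPolynomial.map_X]
    rfl
  · apply Ideal.Quotient.algHom_ext
    ext i : 1
    change G (F (πK (MvPolynomial.X i))) = πK (MvPolynomial.X i)
    have : F₀ (MvPolynomial.X i) =
        MvPolynomial.map (algebraMap k K) (ε (π (MvPolynomial.X i))) := by simp [F₀]
    rw [hF, this, hG, AlgEquiv.symm_apply_apply, hβ, MvPolynomial.map_X]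

end BaseChange

theorem theorem3p8 (k : Type*) [Field k] (p : ℕ) (hp : 0 < p) [CharP k p]
    (m e s : ℕ) (hm : 1 < m) (he : 0 < e) (hs : 0 < s)
    (h₁ : ¬ p ^ e ∣ s * p) (h₂ : ¬ s * p ∣ p ^ e) :
    IsEmpty (AsanumaThreefold k p m e s ≃ₐ[k] MvPolynomial (Fin 3) k) := by
  have hprime : p.Prime := (CharP.char_is_prime_or_zero k p).resolve_right hp.ne'
  have : Fact p.Prime := ⟨hprime⟩
  have : CharP (AlgebraicClosure k) p :=
    charP_of_injective_algebraMap (FaithfulSMul.algebraMap_injective k (AlgebraicClosure k)) p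
  obtain ⟨r, b, hpb, hb⟩ := Nat.exists_eq_pow_mul_and_not_dvd
    (Nat.mul_pos hs hp).ne' p hprime.ne_one
  have hre : r < e := by
    by_contra! h
    exact h₁ (hb ▸ (pow_dvd_pow p h).mul_right b)
  have hr : r ≠ 0 := by
    rintro rfl
    rw [pow_zero, one_mul] at hb
    exact hpb (hb ▸ dvd_mul_left p s)
  have hb2 : 2 ≤ b := by
    have hb0 : b ≠ 0 := fun h => hpb (h ▸ dvd_zero p)
    have hb1 : b ≠ 1 := by
      rintro rfl
      rw [mul_one] at hb
      exact h₂ (hb ▸ pow_dvd_pow p hre.le)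
    omega
  have ha : p ^ e = p ^ r * p ^ (e - r) := by rw [← pow_add]; congr 1; omega
  refine ⟨fun ε => ?_⟩
  obtain ⟨ε'⟩ := AsanumaThreefold.nonempty_algEquiv_of_algebra (K := AlgebraicClosure k) ε
  exact ((AsanumaThreefold.laurentPresentation ha hb).isEmpty_algEquiv (p := p) hm rfl hr
    (pow_pos hp _) (dvd_pow_self p (by omega)) hpb hb2
    (((Nat.Prime.coprime_iff_not_dvd hprime).mpr hpb).pow_left _)).false ε'
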